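/- Let $0<\varepsilon<\Omega$. For $x\in L_1(\mathbb R)$ or $x\in L_2(\mathbb R)$ let $X=\mathcal Fx$ be the Fourier transform, $X(i\omega)=\int_{\mathbb R}e^{-i\omega t}x(t)\,dt$. Let $H^r$ denote the Hardy spaces of the half-plane $\{\mathrm{Re}\,p>0\}$. **Kernels.** $\mathcal K$ is the class of $k:\mathbb R\to\mathbb R$ with $k(t)=0$ for $t>0$ and $(\mathcal Fk)(i\omega)=d(i\omega)/\delta(i\omega)$, where $d,\delta$ are polynomials, $\deg d<\deg\delta$, and every zero $p\in\mathbb C$ of $\delta$ satisfies $\mathrm{Re}\,p>0$, $|\mathrm{Im}\,p|<\Omega$. $\widehat{\mathcal K}$ is the class of $\widehat k\in L_2(\mathbb R)$, real-valued, with $\widehat k(t)=0$ for $t<0$, whose Laplace transform lies in $H^2\cap H^\infty$. **Processes.** $\mathcal X_L$ (resp. $\mathcal X_H$) is the class of $x:\mathbb R\to\mathbb C$ in $L_2(\mathbb R)$ with $X(i\omega)=0$ for a.e. $|\omega|>\Omega$ (resp. a.e. $|\omega|<\Omega$). $\mathcal M_L$ (resp. $\mathcal M_H$) is the class of processes $$x(t)=\frac1{2\pi}\sum_{j=1}^\infty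 c_je^{i\omega_jt}+\frac1{2\pi}\int_{\mathbb R}e^{i\omega t}X_c(\omega)\,d\omega,\qquad \sum_j|c_j|<\infty,\quad X_c\in L_1(\mathbb R),$$ where all $\omega_j\in\mathbb R$ and the support of $X_c$ lie in $\{|\omega|\le\Omega-\varepsilon\}$ (resp. in $\{|\omega|\ge\Omega+\varepsilon\}$). For these, $X=\mathcal Fx$ denotes the functional $\langle f,X\rangle=\sum_jc_jf(\omega_j)+\int fX_c\,d\omega$ on the Banach space $C(\mathbb R)$ of bounded continuous functions, with its dual norm $\|X\|_{C(\mathbb R)^*}$. Below, $\|X\|$ stands for $\|X\|_{L_2(\mathbb R)}$ when $x$ is taken in $\mathcal X_L$ or $\mathcal X_H$, and for $\|X\|_{C(\mathbb R)^*}$ when $x$ is taken in $\mathcal M_L$ or $\mathcal M_H$. **Claim.** Let $k\in\mathcal K$. For $x=x_L+x_H$ with $x_L\in\mathcal X_L\cup\mathcal M_L$ and $x_H\in\mathcal X_H\cup\mathcal M_H$ put $$y(t)=\int_t^\infty k(t-s)x(s)\,ds,\quad y_L(t)=\int_t^\infty k(t-s)x_L(s)\,ds,\quad y_H(t)=\int_t^\infty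 k(t-s)x_H(s)\,ds,$$ and, for $\widehat k_L,\widehat k_H\in\widehat{\mathcal K}$, $$\widehat y_L(t)=\int_{-\infty}^t\widehat k_L(t-s)x_L(s)\,ds,\quad \widehat y_H(t)=\int_{-\infty}^t\widehat k_H(t-s)x_H(s)\,ds,\quad \widehat y=\widehat y_L+\widehat y_H .$$ The integrals defining $y,y_L,y_H$ converge absolutely for every $t$, and $y=y_L+y_H$. An observer of the past of both $x_L$ and $x_H$ can predict $y$ by $\widehat y$, by predicting $y_L$ and $y_H$ separately: (a) for all $r\in[1,\infty]$, all such $x_L,x_H$ and all $\widehat k_L,\widehat k_H\in\widehat{\mathcal K}$ for which the integrals defining $\widehat y_L,\widehat y_H$ converge absolutely for every $t$, $\|y-\widehat y\|_{L_r}\le\|y_L-\widehat y_L\|_{L_r}+\|y_H-\widehat y_H\|_{L_r}$; (b) there are sequences $\widehat k_{L,m},\widehat k_{H,m}\in\widehat{\mathcal K}$, depending only on $k,\Omega,\varepsilon$, such that for all $x_L\in\mathcal X_L\cup\mathcal M_L$ and $x_H\in\mathcal X_H\cup\mathcal M_H$ the $L_\infty(\mathbb R)$-norms of $y_L-\widehat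 y_{L,m}$, $y_H-\widehat y_{H,m}$ and $y-\widehat y_m$ tend to $0$ as $m\to\infty$; (c) for every $\eta>0$ there are $\widehat k_L,\widehat k_H\in\widehat{\mathcal K}$, depending only on $k,\Omega,\varepsilon,\eta$, such that for all $x_L\in\mathcal X_L\cup\mathcal M_L$ and $x_H\in\mathcal X_H\cup\mathcal M_H$, $$\|y_L-\widehat y_L\|_{L_\infty}\le\eta\|X_L\|,\quad \|y_H-\widehat y_H\|_{L_\infty}\le\eta\|X_H\|,\quad \|y-\widehat y\|_{L_\infty}\le\eta\,(\|X_L\|+\|X_H\|),$$ where $X_L=\mathcal Fx_L$, $X_H=\mathcal Fx_H$; (d) the statement of (b) holds with $L_2(\mathbb R)$ in place of $L_\infty(\mathbb R)$ for all $x_L\in\mathcal X_L$, $x_H\in\mathcal X_H$; (e) for every $q\in(2,\infty]$, the statement of (c) holds, for all $x_L\in\mathcal X_L$, $x_H\in\mathcal X_H$, with $L_2$ in place of $L_\infty$ on the left and $\|X_L\|_{L_q}$, $\|X_H\|_{L_q}$ (possibly infinite) on the right; the kernels may also depend on $q$. In (b)–(e) the integrals defining $\widehat y_L,\widehat y_H$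 converge absolutely for every $t$. -/

import Mathlib

open MeasureTheory Filter Topology Set
open scoped ENNReal FourierTransform BoundedContinuousFunction

noncomputable section

/-! ### Fourier and Laplace transforms, Hardy spaces -/

/-- The Fourier transform `X(iω) = ∫ e^{-iωt} x(t) dt` of an integrable function. -/
def angularFourierL1 (x : ℝ → ℂ) (ω : ℝ) : ℂ :=
  ∫ t : ℝ, Complex.exp (-(Complex.I * ω * t)) * x t

open scoped Classical in
/-- The Fourier transform of a square integrable function with the same normalization, a
representative of an element of `L²(ℝ)`.  The transform `𝓕` on `Lp ℂ 2` extends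
`f ↦ ∫ e^{-2πiξt} f(t) dt`, hence the substitution `ξ = ω / (2π)`. -/
def angularFourierL2 (x : ℝ → ℂ) : ℝ → ℂ :=
  if h : MemLp x 2 (volume : Measure ℝ) then
    fun ω => (𝓕 (h.toLp x) : Lp ℂ 2 (volume : Measure ℝ)) (ω / (2 * Real.pi))
  else 0

/-- `X` is the Fourier transform of `x`, where `x` is in `L¹(ℝ)` or in `L²(ℝ)`. -/
def IsFourierTransform (x X : ℝ → ℂ) : Prop :=
  (Integrable x ∧ ∀ ω, X ω = angularFourierL1 x ω) ∨
  (MemLp x 2 (volume : Measure ℝ) ∧ X =ᵐ[volume] angularFourierL2 x)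

/-- The Laplace transform `V(p) = ∫_0^∞ e^{-pt} v(t) dt`. -/
def laplaceTransform (v : ℝ → ℝ) (p : ℂ) : ℂ :=
  ∫ t in Ioi (0 : ℝ), Complex.exp (-(p * t)) * (v t : ℂ)

/-- The Hardy space `H^r` of the right half-plane `{Re p > 0}`. -/
def MemHardy (r : ℝ≥0∞) (h : ℂ → ℂ) : Prop :=
  DifferentiableOn ℂ h {p : ℂ | 0 < p.re} ∧
  (⨆ (s : ℝ) (_ : 0 < s),
    eLpNorm (fun ω : ℝ => h ((s : ℂ) + Complex.I * ω)) r (volume : Measure ℝ)) < ⊤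

/-! ### Kernels -/

/-- The class `𝒦` of anticausal kernels with strictly proper rational transfer function whose
denominator vanishes only where `Re p > 0` and `|Im p| < Ω`. -/
def futureKernels (Ω : ℝ) : Set (ℝ → ℝ) :=
  {k | (∀ t, 0 < t → k t = 0) ∧
    ∃ d δ : Polynomial ℂ, d.degree < δ.degree ∧
      (∀ p : ℂ, δ.eval p = 0 → 0 < p.re ∧ |p.im| < Ω) ∧
      IsFourierTransform (fun t => (k t : ℂ))
        (fun ω => d.eval (Complex.I * ω) / δ.eval (Complex.I * ω))}

/-- The class of causal predicting kernels: the Laplace transform lies in `H² ∩ H^∞`. -/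
def pastKernels : Set (ℝ → ℝ) :=
  {k | (∀ t, t < 0 → k t = 0) ∧ MemLp k 2 (volume : Measure ℝ) ∧
    MemHardy 2 (laplaceTransform k) ∧ MemHardy ⊤ (laplaceTransform k)}

/-- `y(t) = ∫_t^∞ k(t-s) x(s) ds`. -/
def futureConv (k : ℝ → ℝ) (x : ℝ → ℂ) (t : ℝ) : ℂ :=
  ∫ s in Ioi t, (k (t - s) : ℂ) * x s

/-- `ŷ(t) = ∫_{-∞}^t k(t-s) x(s) ds`. -/
def pastConv (k : ℝ → ℝ) (x : ℝ → ℂ) (t : ℝ) : ℂ :=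
  ∫ s in Iic t, (k (t - s) : ℂ) * x s

/-- The integral defining `futureConv k x t` converges absolutely for every `t`. -/
def FutureConverges (k : ℝ → ℝ) (x : ℝ → ℂ) : Prop :=
  ∀ t : ℝ, IntegrableOn (fun s => (k (t - s) : ℂ) * x s) (Ioi t)

/-- The integral defining `pastConv k x t` converges absolutely for every `t`. -/
def PastConverges (k : ℝ → ℝ) (x : ℝ → ℂ) : Prop :=
  ∀ t : ℝ, IntegrableOn (fun s => (k (t - s) : ℂ) * x s) (Iic t)

/-! ### Square integrable processes -/

/-- The class `𝒳_L`. -/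
def lowL2 (Ω : ℝ) : Set (ℝ → ℂ) :=
  {x | MemLp x 2 (volume : Measure ℝ) ∧
    ∀ᵐ ω : ℝ, Ω < |ω| → angularFourierL2 x ω = 0}

/-- The class `𝒳_H`. -/
def highL2 (Ω : ℝ) : Set (ℝ → ℂ) :=
  {x | MemLp x 2 (volume : Measure ℝ) ∧
    ∀ᵐ ω : ℝ, |ω| < Ω → angularFourierL2 x ω = 0}

/-- `‖X‖_{L_q(ℝ)}` for the Fourier transform `X` of `x ∈ L²(ℝ)`; it may be infinite. -/
def fourierNorm (q : ℝ≥0∞) (x : ℝ → ℂ) : ℝ≥0∞ :=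
  eLpNorm (angularFourierL2 x) q (volume : Measure ℝ)

/-! ### Bounded processes given by a discrete and an integrable spectrum -/

/-- Spectral data `({ω_k}, {c_k}, X_c)` with `∑ |c_k| < ∞` and `X_c ∈ L¹(ℝ)`. -/
structure SpectralData where
  freq : ℕ → ℝ
  coeff : ℕ → ℂ
  density : ℝ → ℂ
  summable_coeff : Summable fun j => ‖coeff j‖
  integrable_density : Integrable density

namespace SpectralData

/-- The process `x(t) = (2π)⁻¹ ∑ c_k e^{iω_k t} + (2π)⁻¹ ∫ e^{iωt} X_c(ω) dω`. -/
def process (X : SpectralData) (t : ℝ) : ℂ :=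
  (1 / (2 * Real.pi) : ℂ) * ∑' j, X.coeff j * Complex.exp (Complex.I * X.freq j * t) +
  (1 / (2 * Real.pi) : ℂ) * ∫ ω : ℝ, Complex.exp (Complex.I * ω * t) * X.density ω

/-- `⟨f, X⟩ = ∑ c_k f(ω_k) + ∫ f(ω) X_c(ω) dω`. -/
def pairing (X : SpectralData) (f : ℝ →ᵇ ℂ) : ℂ :=
  (∑' j, X.coeff j * f (X.freq j)) + ∫ ω : ℝ, f ω * X.density ω

theorem norm_coeff_mul_le (X : SpectralData) (f : ℝ →ᵇ ℂ) (j : ℕ) :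
    ‖X.coeff j * f (X.freq j)‖ ≤ ‖X.coeff j‖ * ‖f‖ := by
  rw [norm_mul]
  exact mul_le_mul_of_nonneg_left (f.norm_coe_le_norm _) (norm_nonneg _)

theorem summable_coeff_mul (X : SpectralData) (f : ℝ →ᵇ ℂ) :
    Summable fun j => X.coeff j * f (X.freq j) :=
  Summable.of_norm_bounded (X.summable_coeff.mul_right ‖f‖) (X.norm_coeff_mul_le f)

theorem integrable_mul_density (X : SpectralData) (f : ℝ →ᵇ ℂ) :
    Integrable fun ω : ℝ => f ω * X.density ω :=
  X.integrable_density.bdd_mul f.continuous.aestronglyMeasurable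
    (Eventually.of_forall f.norm_coe_le_norm)

theorem norm_pairing_le (X : SpectralData) (f : ℝ →ᵇ ℂ) :
    ‖X.pairing f‖ ≤ ((∑' j, ‖X.coeff j‖) + ∫ ω : ℝ, ‖X.density ω‖) * ‖f‖ := by
  rw [pairing, add_mul]
  refine (norm_add_le _ _).trans (add_le_add ?_ ?_)
  · rw [← tsum_mul_right]
    exact tsum_of_norm_bounded (X.summable_coeff.mul_right ‖f‖).hasSum (X.norm_coeff_mul_le f)
  · rw [← integral_mul_const]
    refine norm_integral_le_of_norm_le (X.integrable_density.norm.mul_const ‖f‖) ?_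
    refine Eventually.of_forall fun ω => ?_
    rw [norm_mul, mul_comm]
    exact mul_le_mul_of_nonneg_left (f.norm_coe_le_norm _) (norm_nonneg _)

/-- The element of the dual of the space of bounded continuous functions given by the data. -/
def functional (X : SpectralData) : (ℝ →ᵇ ℂ) →L[ℂ] ℂ :=
  LinearMap.mkContinuous
    { toFun := X.pairing
      map_add' := fun f g => by
        simp only [pairing, BoundedContinuousFunction.coe_add, Pi.add_apply, mul_add, add_mul]
        rw [(X.summable_coeff_mul f).tsum_add (X.summable_coeff_mul g),
          integral_add (X.integrable_mul_density f) (X.integrable_mul_density g)]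
        ring
      map_smul' := fun a f => by
        simp only [pairing, BoundedContinuousFunction.coe_smul, smul_eq_mul, RingHom.id_apply,
          mul_add, mul_assoc, integral_const_mul, mul_left_comm _ a, tsum_mul_left] }
    ((∑' j, ‖X.coeff j‖) + ∫ ω : ℝ, ‖X.density ω‖) X.norm_pairing_le

/-- All frequencies, and the support of the density, lie in `B`. -/
def SupportedIn (X : SpectralData) (B : Set ℝ) : Prop :=
  (∀ j, X.freq j ∈ B) ∧ ∀ᵐ ω : ℝ, ω ∉ B → X.density ω = 0

end SpectralData

/-- The class `ℳ_L`. -/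
def lowM (Ω ε : ℝ) : Set (ℝ → ℂ) :=
  {x | ∃ X : SpectralData, X.SupportedIn {ω | |ω| ≤ Ω - ε} ∧ x = X.process}

/-- The class `ℳ_H`. -/
def highM (Ω ε : ℝ) : Set (ℝ → ℂ) :=
  {x | ∃ X : SpectralData, X.SupportedIn {ω | Ω + ε ≤ |ω|} ∧ x = X.process}

/-! ### Processes paired with the norm of their frequency representation -/

/-- The pairs `(x, ‖X‖_{L_q})` with `x` in a class `S` of square integrable processes. -/
def withFourierNorm (q : ℝ≥0∞) (S : Set (ℝ → ℂ)) : Set ((ℝ → ℂ) × ℝ≥0∞) :=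
  {p | p.1 ∈ S ∧ p.2 = fourierNorm q p.1}

/-- The pairs `(x, ‖X‖_{C(ℝ)*})` with `x ∈ S` and `X` any spectral data representing `x`. -/
def withDualNorm (S : Set (ℝ → ℂ)) : Set ((ℝ → ℂ) × ℝ≥0∞) :=
  {p | p.1 ∈ S ∧ ∃ X : SpectralData, p.1 = X.process ∧ p.2 = ‖X.functional‖ₑ}

/-- `𝒳_L ∪ ℳ_L`, each process with the norm belonging to its class: `‖X‖_{L₂}` for `𝒳_L` and
`‖X‖_{C(ℝ)*}` for `ℳ_L`. -/
def lowNormed (Ω ε : ℝ) : Set ((ℝ → ℂ) × ℝ≥0∞) :=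
  withFourierNorm 2 (lowL2 Ω) ∪ withDualNorm (lowM Ω ε)

/-- `𝒳_H ∪ ℳ_H`, each process with the norm belonging to its class. -/
def highNormed (Ω ε : ℝ) : Set ((ℝ → ℂ) × ℝ≥0∞) :=
  withFourierNorm 2 (highL2 Ω) ∪ withDualNorm (highM Ω ε)

/-! ### Weak predictability -/

/-- The prediction error `y - ŷ`. -/
def predictionError (k κ : ℝ → ℝ) (x : ℝ → ℂ) (t : ℝ) : ℂ :=
  futureConv k x t - pastConv κ x t

/-- The error `y - (ŷ_L + ŷ_H)` for `x = x_L + x_H` when the two parts are predicted separately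
from their own past. -/
def jointError (k κL κH : ℝ → ℝ) (xL xH : ℝ → ℂ) (t : ℝ) : ℂ :=
  futureConv k (fun s => xL s + xH s) t - (pastConv κL xL t + pastConv κH xH t)

/-- `κ` is a predicting kernel with `‖y - ŷ‖_{L_r} ≤ η ‖X‖` on a class of processes given with
the norms `‖X‖`. -/
def IsUniformPredictor (r : ℝ≥0∞) (η : ℝ) (k κ : ℝ → ℝ)
    (𝒞 : Set ((ℝ → ℂ) × ℝ≥0∞)) : Prop :=
  κ ∈ pastKernels ∧ ∀ p ∈ 𝒞, PastConverges κ p.1 ∧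
    eLpNorm (predictionError k κ p.1) r (volume : Measure ℝ) ≤ ENNReal.ofReal η * p.2

/-- `κ` is a sequence of predicting kernels with `‖y - ŷ_m‖_{L_r} → 0` for every `x ∈ S`. -/
def IsPredictorSeq (r : ℝ≥0∞) (k : ℝ → ℝ) (κ : ℕ → ℝ → ℝ) (S : Set (ℝ → ℂ)) : Prop :=
  (∀ m, κ m ∈ pastKernels) ∧ ∀ x ∈ S, (∀ m, PastConverges (κ m) x) ∧
    Tendsto (fun m => eLpNorm (predictionError k (κ m) x) r (volume : Measure ℝ)) atTop (𝓝 0)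

/-- Uniform weak `L_r`-predictability of `y` for `x = x_L + x_H` by `ŷ_L + ŷ_H`. -/
def UniformlyPredictableBySum (r : ℝ≥0∞) (k : ℝ → ℝ)
    (𝒞L 𝒞H : Set ((ℝ → ℂ) × ℝ≥0∞)) : Prop :=
  ∀ η : ℝ, 0 < η → ∃ κL κH : ℝ → ℝ,
    IsUniformPredictor r η k κL 𝒞L ∧ IsUniformPredictor r η k κH 𝒞H ∧
    ∀ p ∈ 𝒞L, ∀ q ∈ 𝒞H,
      eLpNorm (jointError k κL κH p.1 q.1) r (volume : Measure ℝ) ≤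
        ENNReal.ofReal η * (p.2 + q.2)

/-- Weak `L_r`-predictability of `y` for `x = x_L + x_H` by `ŷ_L + ŷ_H`. -/
def WeaklyPredictableBySum (r : ℝ≥0∞) (k : ℝ → ℝ) (SL SH : Set (ℝ → ℂ)) : Prop :=
  ∃ κL κH : ℕ → ℝ → ℝ,
    IsPredictorSeq r k κL SL ∧ IsPredictorSeq r k κH SH ∧
    ∀ xL ∈ SL, ∀ xH ∈ SH,
      Tendsto (fun m => eLpNorm (jointError k (κL m) (κH m) xL xH) r (volume : Measure ℝ))
        atTop (𝓝 0)

end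

/-! Write v = 1 / (1 + iω) and w = 2v - 1 = (1 - iω) / (1 + iω), so that the frequency axis becomes
the unit circle without the point w = -1, which stands for ω = ∞. The right half-plane becomes the
disc |w| < 1, and polynomials in v without constant term are the transfer functions of causal
kernels, polynomials times e^{-t}. The transfer function K of k has its poles inside the disc, so
these polynomials cannot in general approximate it on the whole circle.

A low band |ω| ≤ Ω or a high band |ω| ≥ Ω, however, occupies only a proper closed arc, and there
polynomials are uniformly dense (`polynomialFunctions_topologicalClosure_eq_top_of_arc`). Since (1 +
iω) K is continuous up to ω = ∞, approximating it, rather than K, gives a causal kernel κ with |K -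
K_κ| ≤ η |v| on the band, where K_κ is the transfer function of κ (`exists_predicting_kernel`). The
low and high parts thus get different predictors for the same k.

The prediction error is x filtered by g = k - κ. The factor |v| lies in L_s for all s ≥ 2, so for
square integrable x Hölder's inequality bounds the spectrum of the error: in L₁ by ‖v‖₂ ‖X‖₂, which
controls the supremum of the error, and in L₂ by ‖v‖_s ‖X‖_q with 1/s + 1/q = 1/2, which by
Plancherel controls its L₂ norm. For a process with discrete and integrable spectrum the error at
time t is (2π)⁻¹ times its functional applied to e^{iωt} times the transform of g. That transform is
small only on the band, while the dual norm tests functions on all of ℝ; the gap ε leaves room for a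
smooth cutoff that makes it small everywhere without changing it on the spectrum (`HasCutoff`,
`norm_integral_mul_process_le`). The statements about y follow by linearity and the triangle
inequality. -/

/-! ### Polynomial approximation on proper arcs of the unit circle -/

/-- Polynomials are dense in the continuous functions on a compact subset of the unit circle that
misses a ray. -/
theorem polynomialFunctions_topologicalClosure_eq_top_of_arc (E : Set ℂ) [CompactSpace E]
    (hE : ∀ z ∈ E, ‖z‖ = 1) (u : ℂ) (hu : ‖u‖ = 1) (hray : ∀ r : ℝ, 0 ≤ r → (r : ℂ) * u ∉ E) :
    (polynomialFunctions E).topologicalClosure = ⊤ := by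
  set S := (polynomialFunctions E).topologicalClosure with hS
  have hSc : IsClosed (S : Set C(E, ℂ)) := Subalgebra.isClosed_topologicalClosure _
  set X : C(E, ℂ) := Polynomial.toContinuousMapOnAlgHom E Polynomial.X with hX
  have hXapp : ∀ z : E, X z = z := fun z => by simp [hX]
  have hXS : X ∈ S := Subalgebra.le_topologicalClosure _ ⟨Polynomial.X, trivial, rfl⟩
  set x : S := ⟨X, hXS⟩
  -- Passing to a closed subalgebra can enlarge the spectrum only by filling holes, so its boundary
  -- points still belong to the spectrum in C(E), which for the coordinate function is E.
  have hfr : frontier (spectrum ℂ x) ⊆ E := by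
    refine (Subalgebra.frontier_spectrum S (hS := hSc) x).trans ?_
    change spectrum ℂ X ⊆ E
    rw [ContinuousMap.spectrum_eq_range]
    rintro _ ⟨z, rfl⟩
    rw [hXapp]; exact z.2
  have hcs : CompleteSpace S := hSc.completeSpace_coe
  -- Otherwise the ray from 0, which misses E and hence the frontier, would run from the interior of
  -- the spectrum to points beyond the norm bound without crossing the frontier, against
  -- connectedness.
  have h0 : (0 : ℂ) ∉ spectrum ℂ x := by
    intro h0
    set R : Set ℂ := (fun r : ℝ => (r : ℂ) * u) '' Ici 0
    have hR : IsPreconnected R :=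
      isPreconnected_Ici.image _ (by fun_prop)
    have hcov : R ⊆ interior (spectrum ℂ x) ∪ (spectrum ℂ x)ᶜ := by
      rintro _ ⟨r, hr, rfl⟩
      by_contra hn
      simp only [mem_union, mem_compl_iff, not_or, not_not] at hn
      exact hray r hr (hfr ⟨subset_closure hn.2, hn.1⟩)
    have hint : (0 : ℂ) ∈ interior (spectrum ℂ x) := by
      by_contra hn
      exact hray 0 le_rfl (by simpa using hfr ⟨subset_closure h0, hn⟩)
    have hfar : ((‖x‖ * ‖(1 : S)‖ + 1 : ℝ) : ℂ) * u ∈ (spectrum ℂ x)ᶜ := by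
      intro hm
      have := spectrum.norm_le_norm_mul_of_mem hm
      rw [norm_mul, hu, Complex.norm_real, Real.norm_of_nonneg (by positivity)] at this
      linarith
    obtain ⟨_, -, hz1, hz2⟩ := hR _ _ isOpen_interior (spectrum.isClosed x).isOpen_compl hcov
      ⟨0, ⟨0, by simp, by simp⟩, hint⟩
      ⟨_, ⟨_, mem_Ici.2 (by positivity), rfl⟩, hfar⟩
    exact hz2 (interior_subset hz1)
  rw [spectrum.zero_notMem_iff] at h0
  obtain ⟨y, hy⟩ := h0.exists_right_inv
  -- On the unit circle the inverse of the coordinate is its conjugate, so invertibility within `S`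
  -- makes `S` closed under conjugation, and Stone–Weierstrass applies.
  have hstar : star X ∈ S := by
    have : star X = (y : C(E, ℂ)) := by
      ext z
      have h1 : X z * (y : C(E, ℂ)) z = 1 := by
        have := congrArg (fun w : S => (w : C(E, ℂ)) z) hy
        simpa using this
      have h2 : X z * star X z = 1 := by
        rw [ContinuousMap.star_apply, hXapp]
        have := Complex.mul_conj (z : ℂ)
        rw [Complex.normSq_eq_norm_sq, hE z z.2] at this
        simpa using this
      have h3 : X z ≠ 0 := left_ne_zero_of_mul_eq_one h1
      exact mul_left_cancel₀ h3 (h2.trans h1.symm)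
    rw [this]; exact y.2
  have hle : (polynomialFunctions E).starClosure.toSubalgebra ≤ S := by
    rw [polynomialFunctions.starClosure_eq_adjoin_X, StarAlgebra.adjoin_toSubalgebra,
      Algebra.adjoin_le_iff]
    rintro f (hf | hf)
    · rw [mem_singleton_iff.1 hf]; exact hXS
    · rw [Set.mem_star, mem_singleton_iff] at hf
      rw [← star_star f, hf]; exact hstar
  rw [eq_top_iff]
  intro f _
  have hf : f ∈ (polynomialFunctions E).starClosure.topologicalClosure := by
    rw [polynomialFunctions.starClosure_topologicalClosure]; trivial
  have : f ∈ closure ((polynomialFunctions E).starClosure : Set C(E, ℂ)) := hf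
  exact closure_minimal (fun g hg => hle hg) hSc this

theorem exists_polynomial_near_of_arc (E : Set ℂ) (hEc : IsClosed E)
    (hE : ∀ z ∈ E, ‖z‖ = 1) (u : ℂ) (hu : ‖u‖ = 1) (hray : ∀ r : ℝ, 0 ≤ r → (r : ℂ) * u ∉ E)
    (f : ℂ → ℂ) (hf : ContinuousOn f E) (η : ℝ) (hη : 0 < η) :
    ∃ P : Polynomial ℂ, ∀ z ∈ E, ‖f z - P.eval z‖ ≤ η := by
  have hEk : IsCompact E := by
    refine Metric.isCompact_of_isClosed_isBounded hEc ?_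
    refine (Metric.isBounded_closedBall (x := (0 : ℂ)) (r := 1)).subset fun z hz => ?_
    simp [hE z hz]
  have : CompactSpace E := isCompact_iff_compactSpace.1 hEk
  set F : C(E, ℂ) := ⟨fun z => f z, continuousOn_iff_continuous_domRestrict.1 hf⟩
  have hF : F ∈ closure (polynomialFunctions E : Set C(E, ℂ)) := by
    have : F ∈ (polynomialFunctions E).topologicalClosure := by
      rw [polynomialFunctions_topologicalClosure_eq_top_of_arc E hE u hu hray]; trivial
    exact this
  obtain ⟨g, ⟨P, -, rfl⟩, hg⟩ := Metric.mem_closure_iff.1 hF η hη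
  refine ⟨P, fun z hz => ?_⟩
  have := (ContinuousMap.dist_apply_le_dist (f := F) ⟨z, hz⟩).trans hg.le
  rw [dist_eq_norm] at this
  exact this

/-! ### Frequency bands as arcs of the circle -/

/-- A set of frequencies whose image on the unit circle under `ω ↦ (1 - iω) / (1 + iω)` lies in a
proper closed arc, and which is symmetric. -/
structure IsArcBand (B : Set ℝ) : Prop where
  measurableSet : MeasurableSet B
  neg_mem : ∀ ω ∈ B, -ω ∈ B
  exists_arc : ∃ E : Set ℂ, IsClosed E ∧ (∀ z ∈ E, ‖z‖ = 1) ∧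
    (∃ u : ℂ, ‖u‖ = 1 ∧ ∀ r : ℝ, 0 ≤ r → (r : ℂ) * u ∉ E) ∧
    ∀ ω ∈ B, 2 * (1 + Complex.I * ω)⁻¹ - 1 ∈ E

theorem one_add_I_mul_ne_zero (ω : ℝ) : (1 + Complex.I * ω : ℂ) ≠ 0 := by
  intro h
  have := congrArg Complex.re h
  simp at this

theorem cayley_re (ω : ℝ) :
    (2 * (1 + Complex.I * ω : ℂ)⁻¹ - 1).re = 2 / (1 + ω ^ 2) - 1 := by
  rw [Complex.sub_re, Complex.mul_re, Complex.inv_re]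
  simp [Complex.normSq_apply, pow_two, div_eq_mul_inv]

theorem norm_cayley (ω : ℝ) : ‖(2 * (1 + Complex.I * ω : ℂ)⁻¹ - 1)‖ = 1 := by
  have h := one_add_I_mul_ne_zero ω
  have : (2 * (1 + Complex.I * ω : ℂ)⁻¹ - 1) =
      (starRingEnd ℂ) (1 + Complex.I * ω) / (1 + Complex.I * ω) := by
    field_simp
    simp
    ring
  rw [this, norm_div, RCLike.norm_conj, div_self (norm_ne_zero_iff.2 h)]

theorem isArcBand_low {Ω : ℝ} (hΩ : 0 < Ω) : IsArcBand {ω | |ω| ≤ Ω} where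
  measurableSet := (isClosed_le continuous_abs continuous_const).measurableSet
  neg_mem ω hω := by simpa using hω
  exists_arc := by
    refine ⟨{z | ‖z‖ = 1 ∧ 2 / (1 + Ω ^ 2) - 1 ≤ z.re}, ?_, fun z hz => hz.1,
      ⟨-1, by simp, fun r hr hz => ?_⟩, fun ω hω => ⟨norm_cayley ω, ?_⟩⟩
    · exact (isClosed_eq continuous_norm continuous_const).inter
        (isClosed_le continuous_const Complex.continuous_re)
    · obtain ⟨h1, h2⟩ := hz
      simp only [norm_mul, norm_neg, norm_one, mul_one, Complex.norm_real,
        Real.norm_of_nonneg hr] at h1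
      subst h1
      have : 0 < 2 / (1 + Ω ^ 2) := by positivity
      simp at h2
      linarith
    · rw [cayley_re]
      have : ω ^ 2 ≤ Ω ^ 2 := sq_le_sq' (abs_le.1 hω).1 (abs_le.1 hω).2
      gcongr

theorem isArcBand_high {Ω : ℝ} (hΩ : 0 < Ω) : IsArcBand {ω | Ω ≤ |ω|} where
  measurableSet := (isClosed_le continuous_const continuous_abs).measurableSet
  neg_mem ω hω := by simpa using hω
  exists_arc := by
    refine ⟨{z | ‖z‖ = 1 ∧ z.re ≤ 2 / (1 + Ω ^ 2) - 1}, ?_, fun z hz => hz.1,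
      ⟨1, by simp, fun r hr hz => ?_⟩, fun ω hω => ⟨norm_cayley ω, ?_⟩⟩
    · exact (isClosed_eq continuous_norm continuous_const).inter
        (isClosed_le Complex.continuous_re continuous_const)
    · obtain ⟨h1, h2⟩ := hz
      simp only [mul_one, Complex.norm_real,
        Real.norm_of_nonneg hr] at h1
      subst h1
      have : 2 / (1 + Ω ^ 2) < 2 := div_lt_self (by norm_num) (by nlinarith)
      simp at h2
      linarith
    · rw [cayley_re]
      have : Ω ^ 2 ≤ ω ^ 2 := by
        rw [← sq_abs ω]; exact pow_le_pow_left₀ hΩ.le hω 2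
      gcongr

/-- If `(1 + iω) h(ω)` extends continuously to the circle of the points `v = 1 / (1 + iω)` and
`h` has the symmetry of the transform of a real function, then on an arc band `h` is approximated
by polynomials in `v` with real coefficients, with relative accuracy `|v|`. -/
theorem exists_real_coeff_near {B : Set ℝ} (hB : IsArcBand B) (h : ℝ → ℂ) (f : ℂ → ℂ)
    (hf : ContinuousOn f {v | ‖2 * v - 1‖ = 1})
    (hfh : ∀ ω : ℝ, f (1 + Complex.I * ω)⁻¹ = (1 + Complex.I * ω) * h ω)
    (hsymm : ∀ ω, h (-ω) = (starRingEnd ℂ) (h ω)) (η : ℝ) (hη : 0 < η) :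
    ∃ (N : ℕ) (a : ℕ → ℝ), ∀ ω ∈ B,
      ‖h ω - ∑ n ∈ Finset.range N, (a n : ℂ) * ((1 + Complex.I * ω)⁻¹) ^ (n + 1)‖ ≤
        η * ‖(1 + Complex.I * ω : ℂ)⁻¹‖ := by
  obtain ⟨E, hEc, hE, ⟨u, hu, hray⟩, hBE⟩ := hB.exists_arc
  have hg : ContinuousOn (fun w => f ((1 + w) / 2)) E := by
    refine hf.comp (by fun_prop) fun w hw => ?_
    have : 2 * ((1 + w) / 2) - 1 = w := by ring
    simp [this, hE w hw]
  obtain ⟨P, hP⟩ := exists_polynomial_near_of_arc E hEc hE u hu hray _ hg η hη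
  -- The approximation takes place in w = 2v - 1 on the unit circle; this rewrites it in v.
  set Q : Polynomial ℂ := P.comp (2 * Polynomial.X - 1) with hQ
  have hQe : ∀ ω ∈ B, ‖(1 + Complex.I * ω) * h ω - Q.eval (1 + Complex.I * ω)⁻¹‖ ≤ η := by
    intro ω hω
    have := hP _ (hBE ω hω)
    have h2 : (1 + (2 * (1 + Complex.I * ω : ℂ)⁻¹ - 1)) / 2 = (1 + Complex.I * ω)⁻¹ := by ring
    rw [h2, hfh] at this
    simpa [hQ] using this
  have key : ∀ ω ∈ B, ‖h ω - (1 + Complex.I * ω)⁻¹ * Q.eval (1 + Complex.I * ω)⁻¹‖ ≤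
      η * ‖(1 + Complex.I * ω : ℂ)⁻¹‖ := by
    intro ω hω
    have h0 := one_add_I_mul_ne_zero ω
    have : h ω - (1 + Complex.I * ω)⁻¹ * Q.eval (1 + Complex.I * ω)⁻¹ =
        ((1 + Complex.I * ω) * h ω - Q.eval (1 + Complex.I * ω)⁻¹) * (1 + Complex.I * ω)⁻¹ := by
      field_simp
    rw [this, norm_mul]
    gcongr
    exact hQe ω hω
  have hev : ∀ v : ℂ, v * Q.eval v = ∑ n ∈ Finset.range (Q.natDegree + 1),
      Q.coeff n * v ^ (n + 1) := by
    intro v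
    rw [Polynomial.eval_eq_sum_range, Finset.mul_sum]
    exact Finset.sum_congr rfl fun n _ => by ring
  -- By the symmetry of h, conjugating the bound at -ω gives the same bound at ω with conjugated
  -- coefficients. The average of the two approximants has the real parts as coefficients and is no
  -- worse.
  refine ⟨Q.natDegree + 1, fun n => (Q.coeff n).re, fun ω hω => ?_⟩
  have k1 := key ω hω
  have k2 := key (-ω) (hB.neg_mem ω hω)
  rw [hev] at k1 k2
  have hc : ∀ z : ℂ, ‖(starRingEnd ℂ) z‖ = ‖z‖ := fun z => RCLike.norm_conj z
  have hv : (starRingEnd ℂ) ((1 + Complex.I * ((-ω : ℝ) : ℂ))⁻¹) = (1 + Complex.I * ω)⁻¹ := by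
    simp
  rw [← hc, map_sub, hsymm, Complex.conj_conj, map_sum, ← hc (1 + Complex.I * ((-ω : ℝ) : ℂ))⁻¹,
    hv] at k2
  simp only [map_mul, map_pow, hv] at k2
  have : h ω - ∑ n ∈ Finset.range (Q.natDegree + 1),
      ((Q.coeff n).re : ℂ) * ((1 + Complex.I * ω)⁻¹) ^ (n + 1) =
      (1 / 2 : ℂ) * ((h ω - ∑ n ∈ Finset.range (Q.natDegree + 1),
        Q.coeff n * ((1 + Complex.I * ω)⁻¹) ^ (n + 1)) +
        (h ω - ∑ n ∈ Finset.range (Q.natDegree + 1),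
        (starRingEnd ℂ) (Q.coeff n) * ((1 + Complex.I * ω)⁻¹) ^ (n + 1))) := by
    rw [sub_add_sub_comm, ← Finset.sum_add_distrib, mul_sub, Finset.mul_sum]
    congr 1
    · ring
    · refine Finset.sum_congr rfl fun n _ => ?_
      rw [Complex.re_eq_add_conj]; ring
  rw [this, norm_mul]
  have := norm_add_le (h ω - ∑ n ∈ Finset.range (Q.natDegree + 1),
        Q.coeff n * ((1 + Complex.I * ω)⁻¹) ^ (n + 1)) (h ω - ∑ n ∈ Finset.range (Q.natDegree + 1),
        (starRingEnd ℂ) (Q.coeff n) * ((1 + Complex.I * ω)⁻¹) ^ (n + 1))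
  have h2 : ‖(1 / 2 : ℂ)‖ = 1 / 2 := by norm_num
  rw [h2]
  linarith

/-! ### Consistency of the Fourier transforms on `L¹` and `L²` -/

theorem integral_fourier_smul_eq_of_integrable {f : ℝ → ℂ} (hf : Integrable f)
    (g : SchwartzMap ℝ ℂ) : ∫ ξ, (𝓕 g : SchwartzMap ℝ ℂ) ξ • f ξ = ∫ x, g x • 𝓕 f x := by
  have := VectorFourier.integral_fourierIntegral_smul_eq_flip (L := innerₗ ℝ)
    (μ := volume) (ν := volume) (f := (g : ℝ → ℂ)) (g := f)
    Real.continuous_fourierChar continuous_inner g.integrable hf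
  simpa using! this

theorem integral_fourierInv_smul_eq_of_integrable {f : ℝ → ℂ} (hf : Integrable f)
    (g : SchwartzMap ℝ ℂ) : ∫ ξ, (𝓕⁻ g : SchwartzMap ℝ ℂ) ξ • f ξ = ∫ x, g x • 𝓕⁻ f x := by
  have h1 := integral_fourier_smul_eq_of_integrable hf.comp_neg g
  rw [← Real.fourierInv_eq_fourier_comp_neg] at h1
  rw [← h1, ← integral_neg_eq_self]
  congr 1
  ext ξ
  rw [SchwartzMap.fourierInv_coe, SchwartzMap.fourier_coe, Real.fourierInv_eq_fourier_neg, neg_neg]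

/-- Locally integrable functions are determined by their integrals against Schwartz functions. -/
theorem ae_eq_of_integral_schwartz {f f' : ℝ → ℂ} (hf : LocallyIntegrable f)
    (hf' : LocallyIntegrable f')
    (h : ∀ g : SchwartzMap ℝ ℂ, ∫ x, g x • f x = ∫ x, g x • f' x) : f =ᵐ[volume] f' := by
  refine ae_eq_of_integral_contDiff_smul_eq hf hf' fun g hg hc => ?_
  have hc' : HasCompactSupport fun x => (g x : ℂ) := hc.comp_left (g := Complex.ofReal) rfl
  simp only [Complex.real_smul]
  exact h (hc'.toSchwartzMap (Complex.ofRealCLM.contDiff.comp hg))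

theorem continuous_fourier {f : ℝ → ℂ} (hf : Integrable f) : Continuous (𝓕 f) :=
  VectorFourier.fourierIntegral_continuous Real.continuous_fourierChar
    (innerSL ℝ).continuous₂ hf

theorem continuous_fourierInv {f : ℝ → ℂ} (hf : Integrable f) : Continuous (𝓕⁻ f) := by
  rw [Real.fourierInv_eq_fourier_comp_neg]
  exact continuous_fourier hf.comp_neg

/-- Both sides define the same tempered distribution: each moves the transform onto the Schwartz
test function. -/
theorem fourier_toLp_ae_eq {f : ℝ → ℂ} (hf : Integrable f) (hf2 : MemLp f 2) :
    (𝓕 (hf2.toLp f) : Lp ℂ 2 (volume : Measure ℝ)) =ᵐ[volume] 𝓕 f := by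
  refine ae_eq_of_integral_schwartz ((Lp.memLp _).locallyIntegrable (by norm_num))
    (continuous_fourier hf).locallyIntegrable fun g => ?_
  rw [← integral_fourier_smul_eq_of_integrable hf, ← Lp.toTemperedDistribution_apply,
    ← Lp.fourier_toTemperedDistribution_eq, TemperedDistribution.fourier_apply,
    Lp.toTemperedDistribution_apply]
  refine integral_congr_ae ?_
  filter_upwards [hf2.coeFn_toLp] with x hx
  rw [hx]

theorem fourierInv_toLp_ae_eq {f : ℝ → ℂ} (hf : Integrable f) (hf2 : MemLp f 2) :
    (𝓕⁻ (hf2.toLp f) : Lp ℂ 2 (volume : Measure ℝ)) =ᵐ[volume] 𝓕⁻ f := by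
  refine ae_eq_of_integral_schwartz ((Lp.memLp _).locallyIntegrable (by norm_num))
    (continuous_fourierInv hf).locallyIntegrable fun g => ?_
  rw [← integral_fourierInv_smul_eq_of_integrable hf, ← Lp.toTemperedDistribution_apply,
    ← Lp.fourierInv_toTemperedDistribution_eq, TemperedDistribution.fourierInv_apply,
    Lp.toTemperedDistribution_apply]
  refine integral_congr_ae ?_
  filter_upwards [hf2.coeFn_toLp] with x hx
  rw [hx]

/-- Every Schwartz function is the transform of a Schwartz function, so the transform of f
determines all integrals of f against test functions. -/
theorem ae_eq_of_fourier_eq {f f' : ℝ → ℂ} (hf : Integrable f) (hf' : Integrable f')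
    (h : 𝓕 f = 𝓕 f') : f =ᵐ[volume] f' := by
  refine ae_eq_of_integral_schwartz hf.locallyIntegrable hf'.locallyIntegrable fun g => ?_
  have key := fun {f : ℝ → ℂ} (hf : Integrable f) =>
    integral_fourier_smul_eq_of_integrable hf (𝓕⁻ g)
  rw [FourierTransform.fourier_fourierInv_eq] at key
  rw [key hf, key hf', h]

theorem angularFourierL1_eq (x : ℝ → ℂ) (ω : ℝ) :
    angularFourierL1 x ω = 𝓕 x (ω / (2 * Real.pi)) := by
  rw [Real.fourier_eq']
  unfold angularFourierL1
  congr 1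
  ext t
  rw [smul_eq_mul]
  congr 2
  simp only [RCLike.inner_apply, conj_trivial]
  have : (Real.pi : ℂ) ≠ 0 := by exact_mod_cast Real.pi_ne_zero
  push_cast
  field_simp

theorem fourier_eq_angularFourierL1 (x : ℝ → ℂ) (ξ : ℝ) :
    𝓕 x ξ = angularFourierL1 x (2 * Real.pi * ξ) := by
  rw [angularFourierL1_eq, mul_div_cancel_left₀]
  positivity

theorem quasiMeasurePreserving_div_two_pi :
    Measure.QuasiMeasurePreserving (fun ω : ℝ => ω / (2 * Real.pi)) volume volume := by
  refine ⟨by fun_prop, ?_⟩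
  simp_rw [div_eq_mul_inv]
  rw [Real.map_volume_mul_right (by positivity)]
  exact Measure.smul_absolutelyContinuous

theorem quasiMeasurePreserving_two_pi_mul :
    Measure.QuasiMeasurePreserving (fun ω : ℝ => 2 * Real.pi * ω) volume volume := by
  refine ⟨by fun_prop, ?_⟩
  rw [Real.map_volume_mul_left (by positivity)]
  exact Measure.smul_absolutelyContinuous

theorem angularFourierL2_of_memLp {x : ℝ → ℂ} (hx : MemLp x 2) :
    angularFourierL2 x = fun ω : ℝ =>
      (𝓕 (hx.toLp x) : Lp ℂ 2 (volume : Measure ℝ)) (ω / (2 * Real.pi)) := by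
  rw [angularFourierL2, dif_pos hx]

theorem angularFourierL2_ae_eq {x : ℝ → ℂ} (hx1 : Integrable x) (hx : MemLp x 2) :
    angularFourierL2 x =ᵐ[volume] angularFourierL1 x := by
  rw [angularFourierL2_of_memLp hx]
  filter_upwards [quasiMeasurePreserving_div_two_pi.ae (fourier_toLp_ae_eq hx1 hx)] with ω hω
  rw [hω, angularFourierL1_eq]

theorem ae_eq_of_angularFourierL2_ae_eq {x y : ℝ → ℂ} (hx : MemLp x 2) (hy : MemLp y 2)
    (h : angularFourierL2 x =ᵐ[volume] angularFourierL2 y) : x =ᵐ[volume] y := by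
  rw [angularFourierL2_of_memLp hx, angularFourierL2_of_memLp hy] at h
  have h2 : (𝓕 (hx.toLp x) : Lp ℂ 2 (volume : Measure ℝ)) = 𝓕 (hy.toLp y) := by
    refine Lp.ext ?_
    filter_upwards [quasiMeasurePreserving_two_pi_mul.ae h] with ξ hξ
    simpa [mul_div_cancel_left₀ _ Real.two_pi_pos.ne'] using hξ
  have h3 := (Lp.fourierTransformₗᵢ ℝ ℂ).injective h2
  exact (MemLp.toLp_eq_toLp_iff hx hy).1 h3

/-- If the transform of `k` agrees with that of an integrable and square integrable function, then
`k` is that function. -/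
theorem IsFourierTransform.ae_eq {k k₀ X : ℝ → ℂ} (hk : IsFourierTransform k X)
    (h1 : Integrable k₀) (h2 : MemLp k₀ 2) (hX : ∀ ω, angularFourierL1 k₀ ω = X ω) :
    k =ᵐ[volume] k₀ := by
  rcases hk with ⟨hk1, hkX⟩ | ⟨hk2, hkX⟩
  · refine ae_eq_of_fourier_eq hk1 h1 (funext fun ξ => ?_)
    rw [fourier_eq_angularFourierL1, fourier_eq_angularFourierL1, hX, hkX]
  · refine ae_eq_of_angularFourierL2_ae_eq hk2 h2 ?_
    refine hkX.symm.trans ?_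
    refine EventuallyEq.trans ?_ (angularFourierL2_ae_eq h1 h2).symm
    exact Eventually.of_forall fun ω => (hX ω).symm

/-! ### Convolution of an integrable kernel with a square integrable process -/

theorem fourier_conj_comp_sub_left (g : ℝ → ℂ) (t ξ : ℝ) :
    𝓕 (fun s => (starRingEnd ℂ) (g (t - s))) ξ =
      (starRingEnd ℂ) (Complex.exp (2 * Real.pi * Complex.I * t * ξ) * 𝓕 g ξ) := by
  rw [Real.fourier_eq', Real.fourier_eq', ← integral_const_mul, ← integral_conj,
    ← integral_sub_left_eq_self _ volume t]
  congr 1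
  ext s
  simp only [smul_eq_mul, map_mul, sub_sub_cancel, ← Complex.exp_conj, ← mul_assoc,
    ← Complex.exp_add]
  congr 2
  simp [map_ofNat]
  ring

theorem memLp_two_comp_sub_left {g : ℝ → ℂ} (hg : MemLp g 2) (t : ℝ) :
    MemLp (fun s => g (t - s)) 2 :=
  hg.comp_measurePreserving (Measure.measurePreserving_sub_left volume t)

/-- Parseval's identity for x and s ↦ conj (g (t - s)); the reflection and shift turn into the
exponential of the inverse transform. -/
theorem integral_mul_eq_fourierInv {g x : ℝ → ℂ} (hg1 : Integrable g) (hg : MemLp g 2)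
    (hx : MemLp x 2) (t : ℝ) :
    ∫ s, g (t - s) * x s =
      𝓕⁻ (fun ξ => 𝓕 g ξ * (𝓕 (hx.toLp x) : Lp ℂ 2 (volume : Measure ℝ)) ξ) t := by
  have hu1 : Integrable (fun s => (starRingEnd ℂ) (g (t - s))) := by
    have h := hg1.comp_sub_left t
    exact (LinearIsometryEquiv.integrable_comp_iff Complex.conjLIE).2 h
  have hu : MemLp (fun s => (starRingEnd ℂ) (g (t - s))) 2 := by
    refine (memLp_two_comp_sub_left hg t).of_le hu1.aestronglyMeasurable ?_
    exact Eventually.of_forall fun s => by simp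
  have h := Lp.inner_fourier_eq (hu.toLp _) (hx.toLp x)
  rw [L2.inner_def, L2.inner_def] at h
  calc ∫ s, g (t - s) * x s = ∫ a, inner ℂ ((hu.toLp _ : Lp ℂ 2 volume) a) ((hx.toLp x) a) := by
        refine integral_congr_ae ?_
        filter_upwards [hu.coeFn_toLp, hx.coeFn_toLp] with a h1 h2
        rw [h1, h2]
        simp [mul_comm]
    _ = _ := by
        rw [← h, Real.fourierInv_eq']
        refine integral_congr_ae ?_
        filter_upwards [fourier_toLp_ae_eq hu1 hu] with ξ h1
        rw [h1, fourier_conj_comp_sub_left]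
        simp only [RCLike.inner_apply, Complex.conj_conj, smul_eq_mul, conj_trivial]
        push_cast
        ring_nf

/-! ### Causal exponential polynomials -/

/-- The causal function `t ↦ tⁿ e^{-pt} / n!`. -/
noncomputable def causalExp (n : ℕ) (p : ℂ) : ℝ → ℂ :=
  (Ioi (0 : ℝ)).indicator fun t => (t : ℂ) ^ n / (n.factorial : ℂ) * Complex.exp (-(p * t))

theorem integrableOn_pow_mul_exp (n : ℕ) {b : ℝ} (hb : 0 < b) :
    IntegrableOn (fun t : ℝ => t ^ n * Real.exp (-(b * t))) (Ioi 0) := by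
  have := integrableOn_rpow_mul_exp_neg_mul_rpow (p := 1) (s := n) (b := b)
    (by linarith [n.cast_nonneg (α := ℝ)]) one_pos hb
  refine this.congr_fun (fun t _ => ?_) measurableSet_Ioi
  simp [neg_mul]

theorem norm_causalExp_formula (n : ℕ) (p : ℂ) {t : ℝ} (ht : 0 < t) :
    ‖(t : ℂ) ^ n / (n.factorial : ℂ) * Complex.exp (-(p * t))‖ =
      (n.factorial : ℝ)⁻¹ * (t ^ n * Real.exp (-(p.re * t))) := by
  rw [norm_mul, Complex.norm_exp, norm_div, norm_pow, Complex.norm_real,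
    Real.norm_of_nonneg ht.le, Complex.norm_natCast]
  simp
  ring

theorem integrableOn_pow_mul_cexp (n : ℕ) {p : ℂ} (hp : 0 < p.re) :
    IntegrableOn (fun t : ℝ => (t : ℂ) ^ n / (n.factorial : ℂ) * Complex.exp (-(p * t)))
      (Ioi 0) := by
  refine ((integrableOn_pow_mul_exp n hp).const_mul (n.factorial : ℝ)⁻¹).mono' ?_ ?_
  · exact (by fun_prop : Continuous _).aestronglyMeasurable
  · refine (ae_restrict_iff' measurableSet_Ioi).2 (Eventually.of_forall fun t ht => ?_)
    exact (norm_causalExp_formula n p ht).le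

theorem integrable_causalExp (n : ℕ) {p : ℂ} (hp : 0 < p.re) : Integrable (causalExp n p) :=
  (integrable_indicator_iff measurableSet_Ioi).2 (integrableOn_pow_mul_cexp n hp)

theorem memLp_two_causalExp (n : ℕ) {p : ℂ} (hp : 0 < p.re) : MemLp (causalExp n p) 2 := by
  refine (memLp_two_iff_integrable_sq_norm (integrable_causalExp n hp).aestronglyMeasurable).2 ?_
  have h : IntegrableOn (fun t : ℝ => ((n.factorial : ℝ)⁻¹) ^ 2 *
      (t ^ (2 * n) * Real.exp (-((2 * p.re) * t)))) (Ioi 0) :=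
    (integrableOn_pow_mul_exp (2 * n) (by linarith)).const_mul _
  refine ((integrable_indicator_iff measurableSet_Ioi).2 h).congr (Eventually.of_forall fun t => ?_)
  by_cases ht : t ∈ Ioi (0 : ℝ)
  · simp only [causalExp, indicator_of_mem ht]
    rw [norm_causalExp_formula n p ht, mul_pow, mul_pow, ← Real.exp_nat_mul, ← pow_mul, mul_comm n]
    congr 3
    push_cast
    ring_nf
  · simp [causalExp, indicator_of_notMem ht]

theorem tendsto_pow_mul_cexp (n : ℕ) {p : ℂ} (hp : 0 < p.re) :
    Tendsto (fun t : ℝ => (t : ℂ) ^ n / (n.factorial : ℂ) * Complex.exp (-(p * t))) atTop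
      (𝓝 0) := by
  rw [tendsto_zero_iff_norm_tendsto_zero]
  have h := (Real.tendsto_pow_mul_exp_neg_atTop_nhds_zero n).comp
    (tendsto_id.const_mul_atTop hp)
  have h2 := h.const_mul ((n.factorial : ℝ)⁻¹ * (p.re ^ n)⁻¹)
  rw [mul_zero] at h2
  refine h2.congr' ?_
  filter_upwards [eventually_gt_atTop 0] with t ht
  rw [norm_causalExp_formula n p ht]
  simp only [Function.comp, id, mul_pow]
  field_simp

/-- By induction: the derivative of tⁿ⁺¹ e^{-pt} / (n+1)! is the integrand of order n minus p times
that of order n + 1, and it integrates to zero. -/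
theorem integral_pow_mul_cexp (n : ℕ) {p : ℂ} (hp : 0 < p.re) :
    ∫ t in Ioi (0 : ℝ), (t : ℂ) ^ n / (n.factorial : ℂ) * Complex.exp (-(p * t)) =
      (p ^ (n + 1))⁻¹ := by
  have hp0 : p ≠ 0 := fun h => by simp [h] at hp
  have hexp : ∀ t : ℝ, HasDerivAt (fun t : ℝ => Complex.exp (-(p * t)))
      (-p * Complex.exp (-(p * t))) t := fun t => by
    have h1 : HasDerivAt (fun z : ℂ => Complex.exp (-(p * z)))
        (Complex.exp (-(p * t)) * (-(p * 1))) (t : ℂ) :=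
      (((hasDerivAt_id (t : ℂ)).const_mul p).neg).cexp
    convert! h1.comp_ofReal using 1
    ring
  induction n with
  | zero =>
    have hd : ∀ t ∈ Ici (0 : ℝ), HasDerivAt (fun t : ℝ => -p⁻¹ * Complex.exp (-(p * t)))
        ((t : ℂ) ^ 0 / ((0 : ℕ).factorial : ℂ) * Complex.exp (-(p * t))) t := fun t _ => by
      convert! (hexp t).const_mul (-p⁻¹) using 1
      simp
      field_simp
    have ht := (tendsto_pow_mul_cexp 0 hp).const_mul (-p⁻¹)
    rw [integral_Ioi_of_hasDerivAt_of_tendsto' hd (integrableOn_pow_mul_cexp 0 hp)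
      (by simpa using ht)]
    simp
  | succ n ih =>
    have hd : ∀ t ∈ Ici (0 : ℝ), HasDerivAt
        (fun t : ℝ => (t : ℂ) ^ (n + 1) / ((n + 1).factorial : ℂ) * Complex.exp (-(p * t)))
        ((t : ℂ) ^ n / (n.factorial : ℂ) * Complex.exp (-(p * t)) -
          p * ((t : ℂ) ^ (n + 1) / ((n + 1).factorial : ℂ) * Complex.exp (-(p * t)))) t :=
      fun t _ => by
        have h1 : HasDerivAt (fun t : ℝ => (t : ℂ) ^ (n + 1) / ((n + 1).factorial : ℂ))
            ((t : ℂ) ^ n / (n.factorial : ℂ)) t := by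
          have := ((hasDerivAt_pow (n + 1) (t : ℂ)).div_const
            ((n + 1).factorial : ℂ)).comp_ofReal
          convert! this using 1
          have h2 : (n.factorial : ℂ) ≠ 0 := by exact_mod_cast n.factorial_ne_zero
          have h3 : (n + 1 : ℂ) ≠ 0 := by exact_mod_cast n.succ_ne_zero
          rw [Nat.factorial_succ]
          push_cast
          field_simp
        convert! h1.mul (hexp t) using 1
        ring
    have hi := (integrableOn_pow_mul_cexp (n + 1) hp).const_mul p
    have hint := (integrableOn_pow_mul_cexp n hp).sub hi
    have := integral_Ioi_of_hasDerivAt_of_tendsto' hd hint (tendsto_pow_mul_cexp (n + 1) hp)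
    rw [integral_sub (integrableOn_pow_mul_cexp n hp) hi, ih, integral_const_mul] at this
    simp only [Complex.ofReal_zero, ne_eq, Nat.add_eq_zero_iff, one_ne_zero, and_false,
      not_false_eq_true, zero_pow, zero_div, zero_mul, sub_zero] at this
    have h2 := sub_eq_zero.1 this
    rw [eq_comm, ← eq_inv_mul_iff_mul_eq₀ hp0] at h2
    rw [h2, pow_succ p (n + 1), mul_inv, mul_comm]

theorem integral_cexp_mul_causalExp (n : ℕ) (p z : ℂ) (hp : 0 < (p + z).re) :
    ∫ t : ℝ, Complex.exp (-(z * t)) * causalExp n p t = ((p + z) ^ (n + 1))⁻¹ := by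
  rw [← integral_pow_mul_cexp n hp, ← integral_indicator measurableSet_Ioi]
  congr 1
  ext t
  by_cases ht : t ∈ Ioi (0 : ℝ)
  · simp only [causalExp, indicator_of_mem ht]
    rw [mul_left_comm, ← Complex.exp_add]
    ring_nf
  · simp [causalExp, indicator_of_notMem ht]

theorem angularFourierL1_causalExp_neg (n : ℕ) {p : ℂ} (hp : 0 < p.re) (ω : ℝ) :
    angularFourierL1 (fun t => causalExp n p (-t)) ω =
      (-1) ^ (n + 1) * ((Complex.I * ω - p) ^ (n + 1))⁻¹ := by
  have h := integral_cexp_mul_causalExp n p (-(Complex.I * ω)) (by simpa using hp)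
  have h2 : (-1 : ℂ) ^ (n + 1) * ((Complex.I * ω - p) ^ (n + 1))⁻¹ =
      ((p + -(Complex.I * ω)) ^ (n + 1))⁻¹ := by
    rw [show p + -(Complex.I * ω) = -1 * (Complex.I * ω - p) by ring, mul_pow, mul_inv, ← inv_pow]
    norm_num [← inv_pow]
  rw [h2, ← h, ← integral_neg_eq_self]
  simp [angularFourierL1]

theorem norm_cexp_neg_I_mul (ω t : ℝ) : ‖Complex.exp (-(Complex.I * ω * t))‖ = 1 := by
  rw [Complex.norm_exp]
  simp

theorem integrable_cexp_mul {x : ℝ → ℂ} (hx : Integrable x) (ω : ℝ) :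
    Integrable fun t : ℝ => Complex.exp (-(Complex.I * ω * t)) * x t :=
  hx.bdd_mul (c := 1) (by fun_prop : Continuous _).aestronglyMeasurable
    (Eventually.of_forall fun t => (norm_cexp_neg_I_mul ω t).le)

theorem angularFourierL1_add {x y : ℝ → ℂ} (hx : Integrable x) (hy : Integrable y) (ω : ℝ) :
    angularFourierL1 (x + y) ω = angularFourierL1 x ω + angularFourierL1 y ω := by
  simp only [angularFourierL1, Pi.add_apply, mul_add]
  exact integral_add (integrable_cexp_mul hx ω) (integrable_cexp_mul hy ω)

theorem angularFourierL1_smul (c : ℂ) (x : ℝ → ℂ) (ω : ℝ) :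
    angularFourierL1 (c • x) ω = c * angularFourierL1 x ω := by
  simp only [angularFourierL1, Pi.smul_apply, smul_eq_mul, mul_left_comm _ c, integral_const_mul]

/-! ### Partial fractions of transfer functions with poles in the right half-plane -/

/-- The functions `ω ↦ 1 / (iω - p)^{n+1}` with `Re p > 0`. -/
def rightPoleFractions : Set (ℝ → ℂ) :=
  {f | ∃ p : ℂ, 0 < p.re ∧ ∃ n : ℕ, f = fun ω : ℝ => ((Complex.I * ω - p) ^ (n + 1))⁻¹}

theorem I_mul_sub_ne_zero {p : ℂ} (hp : 0 < p.re) (ω : ℝ) : Complex.I * ω - p ≠ 0 := by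
  intro h
  have := congrArg Complex.re h
  simp at this
  linarith

/-- A repeated pole raises the order. For distinct poles, with z = iω, the identity 1 / ((z - q)(z -
p)) = (p - q)⁻¹ (1 / (z - p) - 1 / (z - q)) lowers the order at p by one. -/
theorem inv_mul_rightPoleFraction_mem {q p : ℂ} (hq : 0 < q.re) (hp : 0 < p.re) (n : ℕ) :
    (fun ω : ℝ => (Complex.I * ω - q)⁻¹ * ((Complex.I * ω - p) ^ (n + 1))⁻¹) ∈
      Submodule.span ℂ rightPoleFractions := by
  by_cases hpq : p = q
  · refine Submodule.subset_span ⟨p, hp, n + 1, funext fun ω => ?_⟩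
    rw [← hpq, ← mul_inv, ← pow_succ']
  · have hpq' : p - q ≠ 0 := sub_ne_zero.2 hpq
    induction n with
    | zero =>
      have h : (fun ω : ℝ => (Complex.I * ω - q)⁻¹ * ((Complex.I * ω - p) ^ (0 + 1))⁻¹) =
          (p - q)⁻¹ • ((fun ω : ℝ => ((Complex.I * ω - p) ^ (0 + 1))⁻¹) -
            fun ω : ℝ => ((Complex.I * ω - q) ^ (0 + 1))⁻¹) := by
        ext ω
        have h1 := I_mul_sub_ne_zero hp ω
        have h2 := I_mul_sub_ne_zero hq ω
        simp only [Pi.smul_apply, Pi.sub_apply, smul_eq_mul, zero_add, pow_one]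
        field_simp
        ring
      rw [h]
      exact Submodule.smul_mem _ _ (Submodule.sub_mem _ (Submodule.subset_span ⟨p, hp, 0, rfl⟩)
        (Submodule.subset_span ⟨q, hq, 0, rfl⟩))
    | succ n ih =>
      have h : (fun ω : ℝ => (Complex.I * ω - q)⁻¹ * ((Complex.I * ω - p) ^ (n + 1 + 1))⁻¹) =
          (p - q)⁻¹ • ((fun ω : ℝ => ((Complex.I * ω - p) ^ (n + 1 + 1))⁻¹) -
            fun ω : ℝ => (Complex.I * ω - q)⁻¹ * ((Complex.I * ω - p) ^ (n + 1))⁻¹) := by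
        ext ω
        have h1 := I_mul_sub_ne_zero hp ω
        have h2 := I_mul_sub_ne_zero hq ω
        simp only [Pi.smul_apply, Pi.sub_apply, smul_eq_mul]
        rw [pow_succ _ (n + 1)]
        field_simp
        ring
      rw [h]
      exact Submodule.smul_mem _ _
        (Submodule.sub_mem _ (Submodule.subset_span ⟨p, hp, n + 1, rfl⟩) ih)

theorem inv_mul_mem_span_rightPoleFractions {q : ℂ} (hq : 0 < q.re) {f : ℝ → ℂ}
    (hf : f ∈ Submodule.span ℂ rightPoleFractions) :
    (fun ω : ℝ => (Complex.I * ω - q)⁻¹ * f ω) ∈ Submodule.span ℂ rightPoleFractions := by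
  induction hf using Submodule.span_induction with
  | mem f hf =>
    obtain ⟨p, hp, n, rfl⟩ := hf
    exact inv_mul_rightPoleFraction_mem hq hp n
  | zero =>
    simp only [Pi.zero_apply, mul_zero]
    exact Submodule.zero_mem (Submodule.span ℂ rightPoleFractions)
  | add f g _ _ hf hg => simpa [mul_add] using! Submodule.add_mem _ hf hg
  | smul c f _ hf => simpa [mul_left_comm] using! Submodule.smul_mem _ c hf

theorem div_prod_mem_span_rightPoleFractions (s : Multiset ℂ) (hs : ∀ p ∈ s, 0 < p.re)
    (d : Polynomial ℂ) (hd : d.degree < Multiset.card s) :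
    (fun ω : ℝ => d.eval (Complex.I * ω) /
      (s.map fun p => Polynomial.X - Polynomial.C p).prod.eval (Complex.I * ω)) ∈
      Submodule.span ℂ rightPoleFractions := by
  induction s using Multiset.induction_on generalizing d with
  | empty =>
    have : d = 0 := by simpa using hd
    simp only [this, Polynomial.eval_zero, zero_div]
    exact Submodule.zero_mem (Submodule.span ℂ rightPoleFractions)
  | cons q s ih =>
    have hq := hs q (Multiset.mem_cons_self q s)
    have hs' : ∀ p ∈ s, 0 < p.re := fun p hp => hs p (Multiset.mem_cons_of_mem hp)
    set P := (s.map fun p => Polynomial.X - Polynomial.C p).prod with hP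
    have hPm : P.Monic := Polynomial.monic_multiset_prod_of_monic _ _ fun p _ =>
      Polynomial.monic_X_sub_C p
    have hPdeg : P.degree = Multiset.card s := by
      rw [hP, Polynomial.degree_multiset_prod]
      simp
    have hP0 : ∀ ω : ℝ, P.eval (Complex.I * ω) ≠ 0 := by
      intro ω h
      rw [hP, Polynomial.eval_multiset_prod, Multiset.prod_eq_zero_iff, Multiset.map_map,
        Multiset.mem_map] at h
      obtain ⟨p, hp, h⟩ := h
      exact I_mul_sub_ne_zero (hs' p hp) ω (by simpa using h)
    -- The degree of d is at most that of P, so the quotient is a constant c and, with remainder r,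
    -- d / ((z - q) P) = c / (z - q) + (z - q)⁻¹ (r / P), where r / P falls under the induction
    -- hypothesis.
    have hquo : (d /ₘ P).degree ≤ 0 := by
      by_contra hc
      have h0 : d /ₘ P ≠ 0 := fun h => by simp [h] at hc
      have hle : P.degree ≤ d.degree := by
        by_contra hlt
        exact h0 ((Polynomial.divByMonic_eq_zero_iff hPm).2 (not_le.1 hlt))
      have h1 := Polynomial.degree_add_divByMonic hPm hle
      rw [hPdeg] at h1
      have h2 : (1 : WithBot ℕ) ≤ (d /ₘ P).degree := by
        rw [Polynomial.degree_eq_natDegree h0] at hc ⊢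
        norm_cast at hc ⊢
        omega
      rw [← h1, Multiset.card_cons] at hd
      rw [Polynomial.degree_eq_natDegree h0] at h2 hd
      norm_cast at h2 hd
      omega
    have hmod : (d %ₘ P).degree < Multiset.card s := hPdeg ▸ Polynomial.degree_modByMonic_lt d hPm
    have hbase : (fun ω : ℝ => ((Complex.I * ω - q) ^ (0 + 1))⁻¹) ∈
        Submodule.span ℂ rightPoleFractions := Submodule.subset_span ⟨q, hq, 0, rfl⟩
    have hmem := Submodule.add_mem _ (Submodule.smul_mem _ ((d /ₘ P).coeff 0) hbase)
      (inv_mul_mem_span_rightPoleFractions hq (ih hs' _ hmod))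
    convert! hmem using 1
    ext ω
    have h1 := I_mul_sub_ne_zero hq ω
    have h2 := hP0 ω
    have h3 : d.eval (Complex.I * ω) = (d %ₘ P).eval (Complex.I * ω) +
        P.eval (Complex.I * ω) * (d /ₘ P).coeff 0 := by
      conv_lhs => rw [← Polynomial.modByMonic_add_div d P,
        Polynomial.eq_C_of_degree_le_zero hquo]
      simp
    simp only [Multiset.map_cons, Multiset.prod_cons, Polynomial.eval_mul, Polynomial.eval_sub,
      Polynomial.eval_X, Polynomial.eval_C, Pi.add_apply, Pi.smul_apply, smul_eq_mul, zero_add,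
      pow_one]
    rw [h3, ← hP]
    field_simp
    ring

theorem rational_mem_span_rightPoleFractions (d δ : Polynomial ℂ) (hd : d.degree < δ.degree)
    (hδ : ∀ p : ℂ, δ.eval p = 0 → 0 < p.re) :
    (fun ω : ℝ => d.eval (Complex.I * ω) / δ.eval (Complex.I * ω)) ∈
      Submodule.span ℂ rightPoleFractions := by
  have h0 : δ ≠ 0 := fun h => by simp [h] at hd
  have hsplit := IsAlgClosed.splits δ
  have hprod := hsplit.eq_prod_roots
  have hcard : δ.degree = Multiset.card δ.roots := by
    rw [Polynomial.degree_eq_natDegree h0, hsplit.natDegree_eq_card_roots]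
  have h := Submodule.smul_mem _ δ.leadingCoeff⁻¹
    (div_prod_mem_span_rightPoleFractions δ.roots
      (fun p hp => hδ p (Polynomial.isRoot_of_mem_roots hp)) d (hcard ▸ hd))
  convert! h using 1
  ext ω
  conv_lhs => rw [hprod]
  simp only [Polynomial.eval_mul, Polynomial.eval_C, Pi.smul_apply, smul_eq_mul, div_eq_mul_inv,
    mul_inv]
  ring

/-- A combination of the fractions `1 / (iω - p)^{n+1}` with `Re p > 0` is the Fourier transform
of an integrable and square integrable function. -/
theorem exists_inverse_of_mem_span {h : ℝ → ℂ} (hh : h ∈ Submodule.span ℂ rightPoleFractions) :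
    ∃ k₀ : ℝ → ℂ, Integrable k₀ ∧ MemLp k₀ 2 ∧ ∀ ω, angularFourierL1 k₀ ω = h ω := by
  induction hh using Submodule.span_induction with
  | mem f hf =>
    obtain ⟨p, hp, n, rfl⟩ := hf
    refine ⟨((-1 : ℂ) ^ (n + 1)) • fun t => causalExp n p (-t),
      (integrable_causalExp n hp).comp_neg.smul _,
      ((memLp_two_causalExp n hp).comp_measurePreserving
        (Measure.measurePreserving_neg volume)).const_smul _, fun ω => ?_⟩
    rw [angularFourierL1_smul, angularFourierL1_causalExp_neg n hp, ← mul_assoc, ← mul_pow]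
    simp
  | zero => exact ⟨0, integrable_zero _ _ _, MemLp.zero, fun ω => by simp [angularFourierL1]⟩
  | add f g _ _ hf hg =>
    obtain ⟨a, ha1, ha2, ha⟩ := hf
    obtain ⟨b, hb1, hb2, hb⟩ := hg
    exact ⟨a + b, ha1.add hb1, ha2.add hb2, fun ω => by
      rw [angularFourierL1_add ha1 hb1, ha, hb, Pi.add_apply]⟩
  | smul c f _ hf =>
    obtain ⟨a, ha1, ha2, ha⟩ := hf
    exact ⟨c • a, ha1.smul c, ha2.const_smul c, fun ω => by
      rw [angularFourierL1_smul, ha, Pi.smul_apply, smul_eq_mul]⟩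

/-- A combination `h` of the fractions `1 / (iω - p)^{n+1}` with `Re p > 0` is such that
`(1 + iω) h(ω)` extends continuously to the circle of the points `1 / (1 + iω)`. -/
theorem exists_continuousOn_circle_of_mem_span {h : ℝ → ℂ}
    (hh : h ∈ Submodule.span ℂ rightPoleFractions) :
    ∃ f : ℂ → ℂ, ContinuousOn f {v | ‖2 * v - 1‖ = 1} ∧
      ∀ ω : ℝ, f (1 + Complex.I * ω)⁻¹ = (1 + Complex.I * ω) * h ω := by
  induction hh using Submodule.span_induction with
  | mem f hf =>
    obtain ⟨p, hp, n, rfl⟩ := hf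
    -- Obtained by substituting iω = 1/v - 1. The only pole is v = 1 / (1 + p), that is w = (1 - p)
    -- / (1 + p), which is off the unit circle because |1 - p| = |1 + p| would force Re p = 0.
    refine ⟨fun v => v ^ n / (1 - (1 + p) * v) ^ (n + 1), ?_, fun ω => ?_⟩
    · refine ContinuousOn.div (by fun_prop) (by fun_prop) fun v hv => pow_ne_zero _ fun h0 => ?_
      have hp1 : 1 + p ≠ 0 := fun h => by
        have := congrArg Complex.re h
        simp at this
        linarith
      have hv' : v = (1 + p)⁻¹ := by
        rw [← mul_eq_one_iff_eq_inv₀ hp1]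
        linear_combination -h0
      have hz : 2 * v - 1 = (1 - p) / (1 + p) := by
        rw [hv']
        field_simp
        ring
      rw [mem_ofPred_eq, hz, norm_div, div_eq_one_iff_eq (norm_ne_zero_iff.2 hp1)] at hv
      have := congrArg (· ^ 2) hv
      simp only [← Complex.normSq_eq_norm_sq, Complex.normSq_apply] at this
      simp at this
      nlinarith
    · have h1 := one_add_I_mul_ne_zero ω
      have h2 := I_mul_sub_ne_zero hp ω
      have h3 : 1 - (1 + p) * (1 + Complex.I * ω)⁻¹ =
          (Complex.I * ω - p) * (1 + Complex.I * ω)⁻¹ := by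
        field_simp
        ring
      simp only [h3, mul_pow, pow_succ]
      field_simp
  | zero => exact ⟨0, continuousOn_const, fun ω => by simp⟩
  | add f g _ _ hf hg =>
    obtain ⟨a, ha1, ha⟩ := hf
    obtain ⟨b, hb1, hb⟩ := hg
    exact ⟨a + b, ha1.add hb1, fun ω => by
      rw [Pi.add_apply, ha, hb, Pi.add_apply, mul_add]⟩
  | smul c f _ hf =>
    obtain ⟨a, ha1, ha⟩ := hf
    exact ⟨c • a, ha1.const_smul c, fun ω => by
      rw [Pi.smul_apply, ha, Pi.smul_apply, smul_eq_mul, smul_eq_mul, mul_left_comm]⟩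

/-! ### Predicting kernels -/

/-- The kernel with Laplace transform `∑ aₙ / (1 + p)^{n+1}`. -/
noncomputable def laguerreKernel (N : ℕ) (a : ℕ → ℝ) : ℝ → ℝ :=
  (Ioi (0 : ℝ)).indicator fun t =>
    ∑ n ∈ Finset.range N, a n * (t ^ n / (n.factorial : ℝ) * Real.exp (-t))

theorem ofReal_laguerreKernel (N : ℕ) (a : ℕ → ℝ) :
    (fun t => (laguerreKernel N a t : ℂ)) =
      fun t => ∑ n ∈ Finset.range N, (a n : ℂ) * causalExp n 1 t := by
  ext t
  by_cases ht : t ∈ Ioi (0 : ℝ)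
  · simp [laguerreKernel, causalExp, indicator_of_mem ht]
  · simp [laguerreKernel, causalExp, indicator_of_notMem ht]

theorem integrable_laguerreKernel (N : ℕ) (a : ℕ → ℝ) :
    Integrable fun t => (laguerreKernel N a t : ℂ) := by
  rw [ofReal_laguerreKernel]
  exact integrable_finsetSum _ fun n _ => (integrable_causalExp n (by simp)).const_mul _

theorem memLp_two_ofReal_laguerreKernel (N : ℕ) (a : ℕ → ℝ) :
    MemLp (fun t => (laguerreKernel N a t : ℂ)) 2 := by
  rw [ofReal_laguerreKernel]
  exact memLp_finsetSum _ fun n _ => (memLp_two_causalExp n (by simp)).const_mul _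

/-- The condition on p includes the imaginary axis, so this one formula yields both the Laplace and
the Fourier transform of the kernel. -/
theorem integral_cexp_mul_laguerreKernel (N : ℕ) (a : ℕ → ℝ) {p : ℂ} (hp : 0 < (1 + p).re) :
    ∫ t : ℝ, Complex.exp (-(p * t)) * (laguerreKernel N a t : ℂ) =
      ∑ n ∈ Finset.range N, (a n : ℂ) * ((1 + p)⁻¹) ^ (n + 1) := by
  have h := fun t => congrFun (ofReal_laguerreKernel N a) t
  simp only [h, Finset.mul_sum]
  rw [integral_finsetSum]
  · refine Finset.sum_congr rfl fun n _ => ?_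
    simp only [mul_left_comm _ (a n : ℂ)]
    rw [integral_const_mul, integral_cexp_mul_causalExp n 1 p hp, inv_pow]
  · intro n _
    simp only [mul_left_comm _ (a n : ℂ)]
    refine Integrable.const_mul ?_ _
    refine ((integrable_causalExp n (p := 1 + p) hp)).congr (Eventually.of_forall fun t => ?_)
    by_cases ht : t ∈ Ioi (0 : ℝ)
    · simp only [causalExp, indicator_of_mem ht]
      rw [mul_left_comm, ← Complex.exp_add]
      ring_nf
    · simp [causalExp, indicator_of_notMem ht]

theorem laplaceTransform_laguerreKernel (N : ℕ) (a : ℕ → ℝ) {p : ℂ} (hp : 0 < p.re) :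
    laplaceTransform (laguerreKernel N a) p =
      ∑ n ∈ Finset.range N, (a n : ℂ) * ((1 + p)⁻¹) ^ (n + 1) := by
  rw [← integral_cexp_mul_laguerreKernel N a (by simp; linarith), laplaceTransform,
    ← integral_indicator measurableSet_Ioi]
  congr 1
  ext t
  by_cases ht : t ∈ Ioi (0 : ℝ)
  · rw [indicator_of_mem ht]
  · simp [laguerreKernel, indicator_of_notMem ht]

theorem angularFourierL1_laguerreKernel (N : ℕ) (a : ℕ → ℝ) (ω : ℝ) :
    angularFourierL1 (fun t => (laguerreKernel N a t : ℂ)) ω =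
      ∑ n ∈ Finset.range N, (a n : ℂ) * ((1 + Complex.I * ω)⁻¹) ^ (n + 1) :=
  integral_cexp_mul_laguerreKernel N a (p := Complex.I * ω) (by simp)

theorem memLp_two_inv_one_add_I_mul : MemLp (fun ω : ℝ => (1 + Complex.I * ω)⁻¹) 2 := by
  have hc : Continuous fun ω : ℝ => (1 + Complex.I * ω : ℂ)⁻¹ :=
    Continuous.inv₀ (by fun_prop) one_add_I_mul_ne_zero
  refine (memLp_two_iff_integrable_sq_norm hc.aestronglyMeasurable).2 ?_
  refine integrable_inv_one_add_sq.congr (Eventually.of_forall fun ω => ?_)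
  simp only [norm_inv, inv_pow, ← Complex.normSq_eq_norm_sq, Complex.normSq_apply]
  simp [pow_two]

theorem one_le_norm_one_add {p : ℂ} (hp : 0 ≤ p.re) : 1 ≤ ‖1 + p‖ := by
  refine le_trans ?_ (Complex.abs_re_le_norm _)
  rw [abs_of_nonneg] <;> simp <;> linarith

theorem norm_sum_inv_pow_le (N : ℕ) (a : ℕ → ℝ) {p : ℂ} (hp : 0 ≤ p.re) :
    ‖∑ n ∈ Finset.range N, (a n : ℂ) * ((1 + p)⁻¹) ^ (n + 1)‖ ≤
      (∑ n ∈ Finset.range N, |a n|) * ‖(1 + p)⁻¹‖ := by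
  rw [Finset.sum_mul]
  refine (norm_sum_le _ _).trans (Finset.sum_le_sum fun n _ => ?_)
  rw [norm_mul, Complex.norm_real, norm_pow, Real.norm_eq_abs, pow_succ]
  have h1 : ‖(1 + p)⁻¹‖ ≤ 1 := by
    rw [norm_inv]
    exact inv_le_one_of_one_le₀ (one_le_norm_one_add hp)
  have h2 : ‖(1 + p)⁻¹‖ ^ n ≤ 1 := pow_le_one₀ (norm_nonneg _) h1
  gcongr
  nlinarith [norm_nonneg (1 + p)⁻¹]

/-- Since |1 + p| ≥ 1, higher powers of 1 / (1 + p) are dominated by the first, and moving to the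
right only decreases |1 / (1 + p)|. One boundary function thus bounds the transform on all vertical
lines, for every Hardy exponent. -/
theorem norm_laplaceTransform_laguerreKernel_le (N : ℕ) (a : ℕ → ℝ) {s : ℝ} (hs : 0 < s)
    (ω : ℝ) : ‖laplaceTransform (laguerreKernel N a) (s + Complex.I * ω)‖ ≤
      (∑ n ∈ Finset.range N, |a n|) * ‖(1 + Complex.I * ω)⁻¹‖ := by
  rw [laplaceTransform_laguerreKernel N a (by simpa using hs)]
  refine (norm_sum_inv_pow_le N a (by simpa using hs.le)).trans ?_
  gcongr ?_ * ?_
  rw [norm_inv, norm_inv]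
  refine inv_anti₀ (norm_pos_iff.2 (one_add_I_mul_ne_zero ω)) ?_
  rw [Complex.norm_eq_sqrt_sq_add_sq, Complex.norm_eq_sqrt_sq_add_sq]
  refine Real.sqrt_le_sqrt ?_
  simp
  rw [abs_of_pos (by linarith)]
  linarith

theorem memHardy_laguerreKernel (N : ℕ) (a : ℕ → ℝ) (r : ℝ≥0∞)
    (hr : MemLp (fun ω : ℝ => (1 + Complex.I * ω)⁻¹) r) :
    MemHardy r (laplaceTransform (laguerreKernel N a)) := by
  constructor
  · refine DifferentiableOn.congr (f := fun p => ∑ n ∈ Finset.range N,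
      (a n : ℂ) * ((1 + p)⁻¹) ^ (n + 1)) ?_ fun p hp => laplaceTransform_laguerreKernel N a hp
    refine DifferentiableOn.fun_sum fun n _ => DifferentiableOn.const_mul (DifferentiableOn.pow
      (DifferentiableOn.inv (by fun_prop) fun p hp h => ?_) _) _
    have := one_le_norm_one_add (p := p) (le_of_lt hp)
    rw [h] at this
    norm_num at this
  · refine lt_of_le_of_lt (iSup₂_le fun s hs => eLpNorm_le_mul_eLpNorm_of_ae_le_mul
      (Eventually.of_forall (norm_laplaceTransform_laguerreKernel_le N a hs)) r) ?_
    exact ENNReal.mul_lt_top ENNReal.ofReal_lt_top hr.eLpNorm_lt_top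

theorem norm_inv_one_add_I_mul_le (ω : ℝ) : ‖(1 + Complex.I * ω : ℂ)⁻¹‖ ≤ 1 := by
  rw [norm_inv]
  exact inv_le_one_of_one_le₀ (one_le_norm_one_add (by simp))

theorem memLp_top_inv_one_add_I_mul : MemLp (fun ω : ℝ => (1 + Complex.I * ω)⁻¹) ⊤ := by
  have := memLp_two_inv_one_add_I_mul.aestronglyMeasurable
  exact memLp_top_of_bound this 1 (Eventually.of_forall norm_inv_one_add_I_mul_le)

theorem laguerreKernel_mem_pastKernels (N : ℕ) (a : ℕ → ℝ) :
    laguerreKernel N a ∈ pastKernels := by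
  refine ⟨fun t ht => indicator_of_notMem (by simpa using ht.le) _, ?_,
    memHardy_laguerreKernel N a 2 memLp_two_inv_one_add_I_mul,
    memHardy_laguerreKernel N a ⊤ memLp_top_inv_one_add_I_mul⟩
  simpa using (memLp_two_ofReal_laguerreKernel N a).re

/-! ### Kernels of the class `𝒦` -/

/-- The kernel is known only through its transform. Partial fractions give an explicit function in
L¹ ∩ L² with that transform, and uniqueness identifies k with it almost everywhere. -/
theorem futureKernels_integrable {Ω : ℝ} {k : ℝ → ℝ} (hk : k ∈ futureKernels Ω) :
    Integrable (fun t => (k t : ℂ)) ∧ MemLp (fun t => (k t : ℂ)) 2 ∧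
      angularFourierL1 (fun t => (k t : ℂ)) ∈ Submodule.span ℂ rightPoleFractions := by
  obtain ⟨-, d, δ, hdeg, hδ, hX⟩ := hk
  have hspan := rational_mem_span_rightPoleFractions d δ hdeg fun p hp => (hδ p hp).1
  obtain ⟨k₀, h1, h2, h3⟩ := exists_inverse_of_mem_span hspan
  have hae := hX.ae_eq h1 h2 h3
  refine ⟨h1.congr hae.symm, h2.ae_eq hae.symm, ?_⟩
  convert! hspan using 1
  ext ω
  rw [← h3, angularFourierL1_eq, angularFourierL1_eq, Real.fourier_congr_ae hae]

theorem angularFourierL1_ofReal_neg (k : ℝ → ℝ) (ω : ℝ) :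
    angularFourierL1 (fun t => (k t : ℂ)) (-ω) =
      (starRingEnd ℂ) (angularFourierL1 (fun t => (k t : ℂ)) ω) := by
  simp only [angularFourierL1]
  rw [← integral_conj]
  congr 1
  ext t
  simp [← Complex.exp_conj]

/-- On an arc band the transfer function of `k ∈ 𝒦` is approximated by that of a causal kernel,
with relative accuracy `1 / |1 + iω|`. -/
theorem exists_predicting_kernel {Ω : ℝ} {k : ℝ → ℝ} (hk : k ∈ futureKernels Ω) {B : Set ℝ}
    (hB : IsArcBand B) (η : ℝ) (hη : 0 < η) :
    ∃ κ ∈ pastKernels, Integrable (fun t => (κ t : ℂ)) ∧ MemLp (fun t => (κ t : ℂ)) 2 ∧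
      ∀ ω ∈ B, ‖angularFourierL1 (fun t => (k t : ℂ) - κ t) ω‖ ≤
        η * ‖(1 + Complex.I * ω : ℂ)⁻¹‖ := by
  obtain ⟨hk1, hk2, hspan⟩ := futureKernels_integrable hk
  obtain ⟨f, hf, hfh⟩ := exists_continuousOn_circle_of_mem_span hspan
  obtain ⟨N, a, ha⟩ := exists_real_coeff_near hB _ f hf hfh (angularFourierL1_ofReal_neg k) η hη
  refine ⟨laguerreKernel N a, laguerreKernel_mem_pastKernels N a, integrable_laguerreKernel N a,
    memLp_two_ofReal_laguerreKernel N a, fun ω hω => ?_⟩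
  have h := angularFourierL1_add hk1 ((integrable_laguerreKernel N a).smul (-1 : ℂ)) ω
  rw [angularFourierL1_smul, angularFourierL1_laguerreKernel, neg_one_mul, ← sub_eq_add_neg] at h
  have h2 : (fun t => (k t : ℂ) - laguerreKernel N a t) =
      (fun t => (k t : ℂ)) + (-1 : ℂ) • fun t => (laguerreKernel N a t : ℂ) := by
    ext t
    simp [sub_eq_add_neg]
  rw [h2, h]
  exact ha ω hω

/-! ### Norm bounds for filtered square integrable processes -/

/-- As |v| ≤ 1, the power |v|^s is at most |v|² for finite s ≥ 2. -/
theorem memLp_inv_one_add_I_mul {s : ℝ≥0∞} (hs : 2 ≤ s) :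
    MemLp (fun ω : ℝ => (1 + Complex.I * ω)⁻¹) s := by
  by_cases hs' : s = ⊤
  · rw [hs']
    exact memLp_top_inv_one_add_I_mul
  have hs0 : s ≠ 0 := fun h => by simp [h] at hs
  have hm := memLp_two_inv_one_add_I_mul
  have h2 := (memLp_two_iff_integrable_sq_norm hm.aestronglyMeasurable).1 hm
  have hreal : 2 ≤ s.toReal := by simpa using ENNReal.toReal_mono hs' hs
  rw [← integrable_norm_rpow_iff hm.aestronglyMeasurable hs0 hs']
  refine h2.mono' (hm.aestronglyMeasurable.norm.aemeasurable.pow_const _).aestronglyMeasurable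
    (Eventually.of_forall fun ω => ?_)
  rw [Real.norm_of_nonneg (by positivity), ← Real.rpow_natCast]
  exact Real.rpow_le_rpow_of_exponent_ge (norm_pos_iff.2 (inv_ne_zero (one_add_I_mul_ne_zero ω)))
    (norm_inv_one_add_I_mul_le ω) (by simpa using hreal)

theorem exists_holderTriple_two {q : ℝ≥0∞} (hq : 2 ≤ q) :
    ∃ s : ℝ≥0∞, 2 ≤ s ∧ ENNReal.HolderTriple s q 2 := by
  have hle : q⁻¹ ≤ 2⁻¹ := ENNReal.inv_le_inv.2 hq
  -- The endpoints are included: q = 2 gives s = ∞ and q = ∞ gives s = 2.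
  refine ⟨(2⁻¹ - q⁻¹)⁻¹, ?_, ⟨?_⟩⟩
  · rw [ENNReal.le_inv_iff_le_inv]
    exact tsub_le_self
  · rw [inv_inv, tsub_add_cancel_of_le hle]

/-- Rescaling by ω = 2πξ multiplies Lebesgue measure by 2π ≥ 1, so returning to the variable ξ does
not increase the norm. -/
theorem eLpNorm_fourier_le_fourierNorm {x : ℝ → ℂ} (hx : MemLp x 2) (q : ℝ≥0∞) :
    eLpNorm (𝓕 (hx.toLp x) : Lp ℂ 2 (volume : Measure ℝ)) q volume ≤ fourierNorm q x := by
  rw [fourierNorm, angularFourierL2_of_memLp hx]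
  have hmap : Measure.map (fun ω : ℝ => ω / (2 * Real.pi)) volume =
      ENNReal.ofReal (2 * Real.pi) • volume := by
    simp_rw [div_eq_mul_inv]
    rw [Real.map_volume_mul_right (by positivity), inv_inv, abs_of_pos (by positivity)]
  have h := eLpNorm_map_measure (p := q) (μ := volume) (f := fun ω : ℝ => ω / (2 * Real.pi))
    (g := (𝓕 (hx.toLp x) : Lp ℂ 2 (volume : Measure ℝ)))
    (by rw [hmap]; exact (Lp.aestronglyMeasurable _).smul_measure _) (by fun_prop)
  rw [Function.comp_def] at h
  rw [← h, hmap]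
  refine eLpNorm_mono_measure _ ?_
  have h1 : (1 : ℝ≥0∞) ≤ ENNReal.ofReal (2 * Real.pi) := by
    rw [ENNReal.one_le_ofReal]
    linarith [Real.pi_gt_three]
  intro S
  rw [Measure.smul_apply, smul_eq_mul]
  exact le_mul_of_one_le_left zero_le h1

section Filtered

variable {g x : ℝ → ℂ} (hg1 : Integrable g) (hg : MemLp g 2) (hx : MemLp x 2)

/-- The spectrum of the filtered process. -/
noncomputable def filteredSpectrum (g : ℝ → ℂ) (hx : MemLp x 2) (ξ : ℝ) : ℂ :=
  𝓕 g ξ * (𝓕 (hx.toLp x) : Lp ℂ 2 (volume : Measure ℝ)) ξ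

include hg1

theorem memLp_two_filteredSpectrum : MemLp (filteredSpectrum g hx) 2 := by
  have hb : MemLp (𝓕 g) ⊤ := by
    refine memLp_top_of_bound (continuous_fourier hg1).aestronglyMeasurable (∫ t, ‖g t‖)
      (Eventually.of_forall fun ξ => ?_)
    exact VectorFourier.norm_fourierIntegral_le_integral_norm _ _ _ _ _
  exact (Lp.memLp (𝓕 (hx.toLp x) : Lp ℂ 2 (volume : Measure ℝ))).mul' hb

include hg

theorem integrable_filteredSpectrum : Integrable (filteredSpectrum g hx) := by
  have h : MemLp (𝓕 g) 2 := (Lp.memLp _).ae_eq (fourier_toLp_ae_eq hg1 hg)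
  exact h.integrable_mul (Lp.memLp (𝓕 (hx.toLp x) : Lp ℂ 2 (volume : Measure ℝ)))

/-- Plancherel: the filtered spectrum is in L¹ ∩ L², where the pointwise inverse transform agrees
with the unitary one. -/
theorem eLpNorm_two_filtered :
    eLpNorm (fun t => ∫ s, g (t - s) * x s) 2 volume = eLpNorm (filteredSpectrum g hx) 2 volume := by
  have h1 := integrable_filteredSpectrum hg1 hg hx
  have h2 := memLp_two_filteredSpectrum hg1 hx
  have h3 : (fun t => ∫ s, g (t - s) * x s) = 𝓕⁻ (filteredSpectrum g hx) :=
    funext fun t => integral_mul_eq_fourierInv hg1 hg hx t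
  rw [h3, ← eLpNorm_congr_ae (fourierInv_toLp_ae_eq h1 h2), ← eLpNorm_congr_ae h2.coeFn_toLp,
    ← Lp.enorm_def, ← Lp.enorm_def]
  have h4 : ‖(𝓕⁻ (h2.toLp _) : Lp ℂ 2 (volume : Measure ℝ))‖ = ‖h2.toLp _‖ :=
    (Lp.fourierTransformₗᵢ ℝ ℂ).symm.norm_map _
  rw [← ofReal_norm, ← ofReal_norm, h4]

theorem eLpNorm_top_filtered_le :
    eLpNorm (fun t => ∫ s, g (t - s) * x s) ⊤ volume ≤ eLpNorm (filteredSpectrum g hx) 1 volume := by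
  have h1 := integrable_filteredSpectrum hg1 hg hx
  rw [eLpNorm_exponent_top]
  refine eLpNormEssSup_le_of_ae_enorm_bound (Eventually.of_forall fun t => ?_)
  rw [integral_mul_eq_fourierInv hg1 hg hx t, eLpNorm_one_eq_lintegral_enorm,
    Real.fourierInv_eq]
  refine (enorm_integral_le_lintegral_enorm _).trans (le_of_eq ?_)
  refine lintegral_congr fun ξ => ?_
  rw [← ofReal_norm, ← ofReal_norm, Circle.norm_smul]
  rfl

omit hg1 hg

variable {B : Set ℝ} {η : ℝ} (hη : 0 ≤ η)
  (hG : ∀ ω ∈ B, ‖angularFourierL1 g ω‖ ≤ η * ‖(1 + Complex.I * ω : ℂ)⁻¹‖)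
  (hX : ∀ᵐ ω : ℝ, ω ∉ B → angularFourierL2 x ω = 0)

include hη hG hX

theorem eLpNorm_filteredSpectrum_le (s q r : ℝ≥0∞) [ENNReal.HolderTriple s q r] :
    eLpNorm (filteredSpectrum g hx) r volume ≤
      ENNReal.ofReal η * (eLpNorm (fun ω : ℝ => (1 + Complex.I * ω)⁻¹) s volume *
        fourierNorm q x) := by
  set X := (𝓕 (hx.toLp x) : Lp ℂ 2 (volume : Measure ℝ))
  set v := fun ω : ℝ => (1 + Complex.I * ω)⁻¹
  have hae : ∀ᵐ ξ : ℝ, ‖filteredSpectrum g hx ξ‖ ≤ η * ‖(v • (X : ℝ → ℂ)) ξ‖ := by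
    filter_upwards [quasiMeasurePreserving_two_pi_mul.ae hX] with ξ hξ
    rw [angularFourierL2_of_memLp hx] at hξ
    simp only [mul_div_cancel_left₀ _ Real.two_pi_pos.ne'] at hξ
    rw [filteredSpectrum, fourier_eq_angularFourierL1, norm_mul, Pi.smul_apply', smul_eq_mul,
      norm_mul, ← mul_assoc]
    by_cases hB : 2 * Real.pi * ξ ∈ B
    · refine mul_le_mul_of_nonneg_right ((hG _ hB).trans ?_) (norm_nonneg _)
      refine mul_le_mul_of_nonneg_left ?_ hη
      -- The bound on g is stated at ω = 2πξ, while v is taken at ξ; since 2π ≥ 1, the value at ω is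
      -- the smaller one.
      simp only [v, norm_inv]
      refine inv_anti₀ (norm_pos_iff.2 (one_add_I_mul_ne_zero ξ)) ?_
      rw [Complex.norm_eq_sqrt_sq_add_sq, Complex.norm_eq_sqrt_sq_add_sq]
      refine Real.sqrt_le_sqrt ?_
      have : 1 ≤ (2 * Real.pi) ^ 2 := by nlinarith [Real.pi_gt_three]
      simp
      nlinarith [sq_nonneg ξ]
    · rw [hξ hB]
      simp
  refine (eLpNorm_le_mul_eLpNorm_of_ae_le_mul hae r).trans ?_
  gcongr
  refine (eLpNorm_smul_le_mul_eLpNorm (p := s) (q := q) (Lp.aestronglyMeasurable _)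
    memLp_two_inv_one_add_I_mul.aestronglyMeasurable).trans ?_
  gcongr
  exact eLpNorm_fourier_le_fourierNorm hx q

end Filtered

/-! ### Filtered processes with discrete and integrable spectrum -/

theorem norm_cexp_I_mul (ω t : ℝ) : ‖Complex.exp (Complex.I * ω * t)‖ = 1 := by
  rw [Complex.norm_exp]
  simp

theorem continuous_angularFourierL1 {h : ℝ → ℂ} (hh : Integrable h) :
    Continuous (angularFourierL1 h) := by
  have : angularFourierL1 h = fun ω => 𝓕 h (ω / (2 * Real.pi)) :=
    funext (angularFourierL1_eq h)
  rw [this]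
  exact (continuous_fourier hh).comp (by fun_prop)

theorem norm_angularFourierL1_le (h : ℝ → ℂ) (ω : ℝ) :
    ‖angularFourierL1 h ω‖ ≤ ∫ t, ‖h t‖ := by
  refine (norm_integral_le_integral_norm _).trans (le_of_eq ?_)
  simp only [norm_mul, norm_cexp_neg_I_mul, one_mul]

/-- The bounded continuous function `ω ↦ e^{iωt} (𝓕 h)(iω)`. -/
noncomputable def shiftedTransfer {h : ℝ → ℂ} (hh : Integrable h) (t : ℝ) : ℝ →ᵇ ℂ :=
  BoundedContinuousFunction.ofNormedAddCommGroup
    (fun ω : ℝ => Complex.exp (Complex.I * ω * t) * angularFourierL1 h ω)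
    ((by fun_prop : Continuous fun ω : ℝ => Complex.exp (Complex.I * ω * t)).mul
      (continuous_angularFourierL1 hh)) (∫ t, ‖h t‖) fun ω => by
    rw [norm_mul, norm_cexp_I_mul, one_mul]
    exact norm_angularFourierL1_le h ω

theorem shiftedTransfer_apply {h : ℝ → ℂ} (hh : Integrable h) (t ω : ℝ) :
    shiftedTransfer hh t ω = Complex.exp (Complex.I * ω * t) * angularFourierL1 h ω := rfl

theorem integral_comp_sub_left_mul_cexp (h : ℝ → ℂ) (t ω : ℝ) :
    ∫ s : ℝ, h (t - s) * Complex.exp (Complex.I * ω * s) =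
      Complex.exp (Complex.I * ω * t) * angularFourierL1 h ω := by
  rw [angularFourierL1, ← integral_const_mul, ← integral_sub_left_eq_self _ volume t]
  congr 1
  ext s
  rw [sub_sub_cancel, ← mul_assoc, ← Complex.exp_add, mul_comm]
  congr 2
  push_cast
  ring

theorem integrable_comp_sub_left_mul_cexp {h : ℝ → ℂ} (hh : Integrable h) (t ω : ℝ) :
    Integrable fun s : ℝ => h (t - s) * Complex.exp (Complex.I * ω * s) :=
  (hh.comp_sub_left t).mul_bdd (c := 1) (by fun_prop : Continuous _).aestronglyMeasurable
    (Eventually.of_forall fun s => (norm_cexp_I_mul ω s).le)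

namespace SpectralData

theorem integral_discrete_part (X : SpectralData) {h : ℝ → ℂ} (hh : Integrable h) (t : ℝ) :
    ∫ s : ℝ, h (t - s) * ∑' j, X.coeff j * Complex.exp (Complex.I * X.freq j * s) =
      ∑' j, X.coeff j * shiftedTransfer hh t (X.freq j) := by
  have hF : ∀ j, Integrable fun s : ℝ =>
      X.coeff j * (h (t - s) * Complex.exp (Complex.I * X.freq j * s)) := fun j =>
    (integrable_comp_sub_left_mul_cexp hh t _).const_mul _
  have hS : Summable fun j => ∫ s : ℝ,
      ‖X.coeff j * (h (t - s) * Complex.exp (Complex.I * X.freq j * s))‖ := by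
    refine (X.summable_coeff.mul_right (∫ s, ‖h (t - s)‖)).congr fun j => ?_
    simp only [norm_mul, norm_cexp_I_mul, mul_one]
    rw [integral_const_mul]
  have := (hasSum_integral_of_summable_integral_norm hF hS).tsum_eq
  simp only [integral_const_mul, integral_comp_sub_left_mul_cexp] at this
  rw [show (∑' j, X.coeff j * shiftedTransfer hh t (X.freq j)) = _ from this]
  congr 1
  ext s
  rw [← tsum_mul_left]
  exact tsum_congr fun j => by ring

theorem integral_continuous_part (X : SpectralData) {h : ℝ → ℂ} (hh : Integrable h) (t : ℝ) :
    ∫ s : ℝ, h (t - s) * ∫ ω : ℝ, Complex.exp (Complex.I * ω * s) * X.density ω =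
      ∫ ω : ℝ, shiftedTransfer hh t ω * X.density ω := by
  have hI : Integrable (fun p : ℝ × ℝ =>
      Complex.exp (Complex.I * p.2 * p.1) * (h (t - p.1) * X.density p.2))
      (volume.prod volume) :=
    ((hh.comp_sub_left t).mul_prod X.integrable_density).bdd_mul (c := 1)
      (by fun_prop : Continuous _).aestronglyMeasurable
      (Eventually.of_forall fun p => (norm_cexp_I_mul p.2 p.1).le)
  have hs := integral_integral_swap (f := fun s ω : ℝ =>
      Complex.exp (Complex.I * ω * s) * (h (t - s) * X.density ω)) hI
  calc _ = ∫ s : ℝ, ∫ ω : ℝ, Complex.exp (Complex.I * ω * s) * (h (t - s) * X.density ω) := by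
        congr 1
        ext s
        rw [← integral_const_mul]
        congr 1
        ext ω
        ring
    _ = _ := by
        rw [hs]
        congr 1
        ext ω
        rw [shiftedTransfer_apply, ← integral_comp_sub_left_mul_cexp, ← integral_mul_const]
        congr 1
        ext s
        ring

theorem continuous_discrete (X : SpectralData) :
    Continuous fun t : ℝ => ∑' j, X.coeff j * Complex.exp (Complex.I * X.freq j * t) :=
  continuous_tsum (fun j => by fun_prop) X.summable_coeff fun j t => by
    rw [norm_mul, norm_cexp_I_mul, mul_one]

theorem continuous_part_eq (X : SpectralData) (t : ℝ) :
    ∫ ω : ℝ, Complex.exp (Complex.I * ω * t) * X.density ω = angularFourierL1 X.density (-t) := by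
  rw [angularFourierL1]
  congr 1
  ext ω
  congr 2
  push_cast
  ring

theorem continuous_process (X : SpectralData) : Continuous X.process := by
  unfold process
  simp only [continuous_part_eq]
  exact (continuous_const.mul X.continuous_discrete).add
    (continuous_const.mul ((continuous_angularFourierL1 X.integrable_density).comp continuous_neg))

theorem norm_discrete_le (X : SpectralData) (t : ℝ) :
    ‖∑' j, X.coeff j * Complex.exp (Complex.I * X.freq j * t)‖ ≤ ∑' j, ‖X.coeff j‖ :=
  tsum_of_norm_bounded X.summable_coeff.hasSum fun j => by
    rw [norm_mul, norm_cexp_I_mul, mul_one]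

theorem norm_continuous_part_le (X : SpectralData) (t : ℝ) :
    ‖∫ ω : ℝ, Complex.exp (Complex.I * ω * t) * X.density ω‖ ≤ ∫ ω, ‖X.density ω‖ := by
  rw [continuous_part_eq]
  exact norm_angularFourierL1_le _ _

theorem exists_norm_process_le (X : SpectralData) : ∃ C, ∀ t, ‖X.process t‖ ≤ C := by
  refine ⟨‖(1 / (2 * Real.pi) : ℂ)‖ * (∑' j, ‖X.coeff j‖) +
    ‖(1 / (2 * Real.pi) : ℂ)‖ * ∫ ω, ‖X.density ω‖, fun t => ?_⟩
  refine (norm_add_le _ _).trans ?_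
  rw [norm_mul, norm_mul]
  gcongr
  · exact X.norm_discrete_le t
  · exact X.norm_continuous_part_le t

/-- Filtering a process amounts to applying its functional to the shifted transfer function. -/
theorem integral_mul_process (X : SpectralData) {h : ℝ → ℂ} (hh : Integrable h) (t : ℝ) :
    ∫ s, h (t - s) * X.process s =
      (1 / (2 * Real.pi) : ℂ) * X.functional (shiftedTransfer hh t) := by
  have h1 : Integrable fun s : ℝ =>
      h (t - s) * ∑' j, X.coeff j * Complex.exp (Complex.I * X.freq j * s) :=
    (hh.comp_sub_left t).mul_bdd X.continuous_discrete.aestronglyMeasurable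
      (Eventually.of_forall X.norm_discrete_le)
  have h2 : Integrable fun s : ℝ =>
      h (t - s) * ∫ ω : ℝ, Complex.exp (Complex.I * ω * s) * X.density ω := by
    refine (hh.comp_sub_left t).mul_bdd ?_ (Eventually.of_forall X.norm_continuous_part_le)
    simp only [continuous_part_eq]
    exact ((continuous_angularFourierL1 X.integrable_density).comp
      continuous_neg).aestronglyMeasurable
  have h3 : (fun s => h (t - s) * X.process s) = fun s : ℝ =>
      (1 / (2 * Real.pi) : ℂ) *
        (h (t - s) * ∑' j, X.coeff j * Complex.exp (Complex.I * X.freq j * s)) +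
      (1 / (2 * Real.pi) : ℂ) *
        (h (t - s) * ∫ ω : ℝ, Complex.exp (Complex.I * ω * s) * X.density ω) := by
    ext s
    rw [process]
    ring
  rw [h3, integral_add (h1.const_mul _) (h2.const_mul _), integral_const_mul, integral_const_mul,
    X.integral_discrete_part hh, X.integral_continuous_part hh, ← mul_add]
  rfl

theorem SupportedIn.functional_congr {X : SpectralData} {S : Set ℝ} (hX : X.SupportedIn S)
    {f f' : ℝ →ᵇ ℂ} (h : ∀ ω ∈ S, f ω = f' ω) : X.functional f = X.functional f' := by
  change X.pairing f = X.pairing f'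
  unfold pairing
  congr 1
  · exact tsum_congr fun j => by rw [h _ (hX.1 j)]
  · refine integral_congr_ae ?_
    filter_upwards [hX.2] with ω hω
    by_cases hS : ω ∈ S
    · rw [h ω hS]
    · rw [hω hS, mul_zero, mul_zero]

end SpectralData

/-! ### Smooth cutoffs and the dual-norm bound -/

/-- The product of a transfer function with a smooth cutoff is a transfer function. -/
theorem exists_integrable_transfer_mul_bump {g : ℝ → ℂ} (hg : Integrable g)
    (b : ContDiffBump (0 : ℝ)) : ∃ h : ℝ → ℂ, Integrable h ∧
      ∀ ω, angularFourierL1 h ω = (b ω : ℂ) * angularFourierL1 g ω := by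
  have hcd : ContDiff ℝ ((⊤ : ℕ∞) : WithTop ℕ∞) fun ξ : ℝ => (b (2 * Real.pi * ξ) : ℂ) :=
    Complex.ofRealCLM.contDiff.comp (b.contDiff.comp (by fun_prop))
  have hcs : HasCompactSupport fun ξ : ℝ => (b (2 * Real.pi * ξ) : ℂ) :=
    (b.hasCompactSupport.comp_homeomorph
      (Homeomorph.mulLeft₀ (2 * Real.pi) (by positivity))).comp_left (g := Complex.ofReal) rfl
  set φ : SchwartzMap ℝ ℂ := hcs.toSchwartzMap hcd
  -- Convolution with β multiplies the transform by φ, the bump rescaled to the variable ξ.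
  set β : SchwartzMap ℝ ℂ := 𝓕⁻ φ
  refine ⟨convolution β g (ContinuousLinearMap.mul ℂ ℂ) volume,
    β.integrable.integrable_convolution _ hg, fun ω => ?_⟩
  rw [angularFourierL1_eq, angularFourierL1_eq, Real.fourier_mul_convolution_eq β.integrable hg]
  congr 1
  rw [← SchwartzMap.fourier_coe, FourierTransform.fourier_fourierInv_eq]
  change (b (2 * Real.pi * (ω / (2 * Real.pi))) : ℂ) = b ω
  rw [mul_div_cancel₀ _ Real.two_pi_pos.ne']

/-- Bound for a filtered process by the norm of any spectral data representing it. -/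
theorem norm_integral_mul_process_le {g : ℝ → ℂ} (hg : Integrable g) {h : ℝ → ℂ}
    (hh : Integrable h) {X X' : SpectralData} (hXX : X.process = X'.process) {S : Set ℝ}
    (hX' : X'.SupportedIn S) (hgh : ∀ ω ∈ S, angularFourierL1 g ω = angularFourierL1 h ω)
    {η : ℝ} (hη : 0 ≤ η) (hbound : ∀ ω, ‖angularFourierL1 h ω‖ ≤ η) (t : ℝ) :
    ‖∫ s, g (t - s) * X.process s‖ ≤ η * ‖X.functional‖ := by
  -- Filtering sees only the process, so g may be exchanged for h through the representation X',
  -- whose spectrum lies in S; the norm bound is then taken with X, about whose support nothing is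
  -- known.
  have h1 : ∫ s, g (t - s) * X.process s = ∫ s, h (t - s) * X.process s := by
    rw [hXX, X'.integral_mul_process hg, X'.integral_mul_process hh]
    congr 1
    refine hX'.functional_congr fun ω hω => ?_
    rw [shiftedTransfer_apply, shiftedTransfer_apply, hgh ω hω]
  have h2 : ‖shiftedTransfer hh t‖ ≤ η := by
    refine (BoundedContinuousFunction.norm_le hη).2 fun ω => ?_
    rw [shiftedTransfer_apply, norm_mul, norm_cexp_I_mul, one_mul]
    exact hbound ω
  have h3 : ‖(1 / (2 * Real.pi) : ℂ)‖ ≤ 1 := by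
    have : (1 / (2 * Real.pi) : ℂ) = ((1 / (2 * Real.pi) : ℝ) : ℂ) := by push_cast; rfl
    rw [this, Complex.norm_real, Real.norm_of_nonneg (by positivity),
      div_le_one (by positivity)]
    linarith [Real.pi_gt_three]
  rw [h1, X.integral_mul_process hh, norm_mul, mul_comm η]
  calc _ ≤ 1 * (‖X.functional‖ * ‖shiftedTransfer hh t‖) := by
        gcongr
        exact X.functional.le_opNorm _
    _ ≤ _ := by
        rw [one_mul]
        gcongr

/-! ### Prediction errors as filtered processes -/

/-- Processes that are square integrable, or bounded and measurable. -/
def IsL2OrBounded (x : ℝ → ℂ) : Prop :=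
  MemLp x 2 (volume : Measure ℝ) ∨
    (AEStronglyMeasurable x (volume : Measure ℝ) ∧ ∃ C, ∀ s, ‖x s‖ ≤ C)

theorem SpectralData.isL2OrBounded_process (X : SpectralData) : IsL2OrBounded X.process :=
  Or.inr ⟨X.continuous_process.aestronglyMeasurable, X.exists_norm_process_le⟩

theorem IsL2OrBounded.aestronglyMeasurable {x : ℝ → ℂ} (hx : IsL2OrBounded x) :
    AEStronglyMeasurable x (volume : Measure ℝ) :=
  hx.elim (fun h => h.aestronglyMeasurable) fun h => h.1

theorem IsL2OrBounded.integrable_mul {x : ℝ → ℂ} (hx : IsL2OrBounded x) {g : ℝ → ℂ}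
    (hg1 : Integrable g) (hg : MemLp g 2) (t : ℝ) : Integrable fun s => g (t - s) * x s := by
  rcases hx with hx | ⟨hx, C, hC⟩
  · exact (memLp_two_comp_sub_left hg t).integrable_mul hx
  · exact (hg1.comp_sub_left t).mul_bdd hx (Eventually.of_forall hC)

theorem futureConv_eq_integral {k : ℝ → ℝ} (hk : ∀ t, 0 < t → k t = 0) (x : ℝ → ℂ) (t : ℝ) :
    futureConv k x t = ∫ s, (k (t - s) : ℂ) * x s := by
  -- The value k 0 need not vanish, so the endpoint s = t is added to make the integrand zero off
  -- the domain.
  rw [futureConv, ← integral_Ici_eq_integral_Ioi]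
  refine setIntegral_eq_integral_of_forall_compl_eq_zero fun s hs => ?_
  rw [hk _ (sub_pos.2 (not_le.1 hs))]
  simp

theorem pastConv_eq_integral {κ : ℝ → ℝ} (hκ : ∀ t, t < 0 → κ t = 0) (x : ℝ → ℂ) (t : ℝ) :
    pastConv κ x t = ∫ s, (κ (t - s) : ℂ) * x s := by
  rw [pastConv]
  refine setIntegral_eq_integral_of_forall_compl_eq_zero fun s hs => ?_
  rw [hκ _ (sub_neg.2 (not_le.1 hs))]
  simp

theorem predictionError_eq_integral {k κ : ℝ → ℝ} (hk : ∀ t, 0 < t → k t = 0)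
    (hk1 : Integrable fun t => (k t : ℂ)) (hk2 : MemLp (fun t => (k t : ℂ)) 2)
    (hκ : ∀ t, t < 0 → κ t = 0) (hκ1 : Integrable fun t => (κ t : ℂ))
    (hκ2 : MemLp (fun t => (κ t : ℂ)) 2) {x : ℝ → ℂ} (hx : IsL2OrBounded x) :
    predictionError k κ x = fun t => ∫ s, ((k (t - s) : ℂ) - κ (t - s)) * x s := by
  ext t
  rw [predictionError, futureConv_eq_integral hk, pastConv_eq_integral hκ,
    ← integral_sub (hx.integrable_mul hk1 hk2 t) (hx.integrable_mul hκ1 hκ2 t)]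
  simp only [sub_mul]

theorem aestronglyMeasurable_integral_comp_sub_mul {g x : ℝ → ℂ}
    (hg : AEStronglyMeasurable g (volume : Measure ℝ))
    (hx : AEStronglyMeasurable x (volume : Measure ℝ)) :
    AEStronglyMeasurable (fun t => ∫ s, g (t - s) * x s) (volume : Measure ℝ) := by
  have h := (hx.convolution_integrand (μ := (volume : Measure ℝ))
    (ContinuousLinearMap.mul ℂ ℂ) hg).integral_prod_right'
  simpa [mul_comm] using h

/-- Needed for the triangle inequality in L_r with arbitrary predicting kernels. These need not be
integrable, so the two convolutions are treated separately instead of as one with k - κ. -/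
theorem aestronglyMeasurable_predictionError {Ω : ℝ} {k κ : ℝ → ℝ} (hk : k ∈ futureKernels Ω)
    (hκ : κ ∈ pastKernels) {x : ℝ → ℂ} (hx : IsL2OrBounded x) :
    AEStronglyMeasurable (predictionError k κ x) (volume : Measure ℝ) := by
  have h : predictionError k κ x =
      (fun t => ∫ s, (k (t - s) : ℂ) * x s) - fun t => ∫ s, (κ (t - s) : ℂ) * x s := by
    ext t
    rw [predictionError, futureConv_eq_integral hk.1, pastConv_eq_integral hκ.1, Pi.sub_apply]
  rw [h]
  exact (aestronglyMeasurable_integral_comp_sub_mul (futureKernels_integrable hk).1.1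
      hx.aestronglyMeasurable).sub
    (aestronglyMeasurable_integral_comp_sub_mul hκ.2.1.ofReal.1 hx.aestronglyMeasurable)

theorem futureConverges_of_mem {Ω : ℝ} {k : ℝ → ℝ} (hk : k ∈ futureKernels Ω) {x : ℝ → ℂ}
    (hx : IsL2OrBounded x) : FutureConverges k x := fun t =>
  (hx.integrable_mul (futureKernels_integrable hk).1
    (futureKernels_integrable hk).2.1 t).integrableOn

theorem futureConv_add {k : ℝ → ℝ} {x y : ℝ → ℂ} (hx : FutureConverges k x)
    (hy : FutureConverges k y) (t : ℝ) :
    futureConv k (fun s => x s + y s) t = futureConv k x t + futureConv k y t := by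
  simp only [futureConv, mul_add]
  exact integral_add (hx t) (hy t)

theorem eLpNorm_jointError_le {Ω : ℝ} {k κL κH : ℝ → ℝ} (hk : k ∈ futureKernels Ω)
    (hL : κL ∈ pastKernels) (hH : κH ∈ pastKernels) {xL xH : ℝ → ℂ} (hxL : IsL2OrBounded xL)
    (hxH : IsL2OrBounded xH) {r : ℝ≥0∞} (hr : 1 ≤ r) :
    eLpNorm (jointError k κL κH xL xH) r (volume : Measure ℝ) ≤
      eLpNorm (predictionError k κL xL) r (volume : Measure ℝ) +
        eLpNorm (predictionError k κH xH) r (volume : Measure ℝ) := by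
  have h : jointError k κL κH xL xH = predictionError k κL xL + predictionError k κH xH := by
    ext t
    rw [jointError, futureConv_add (futureConverges_of_mem hk hxL) (futureConverges_of_mem hk hxH),
      Pi.add_apply, predictionError, predictionError]
    ring
  rw [h]
  exact eLpNorm_add_le (aestronglyMeasurable_predictionError hk hL hxL)
    (aestronglyMeasurable_predictionError hk hH hxH) hr

/-! ### Prediction on a band -/

/-- Square integrable processes with spectrum in `B`. -/
def bandL2 (B : Set ℝ) : Set (ℝ → ℂ) :=
  {x | MemLp x 2 (volume : Measure ℝ) ∧ ∀ᵐ ω : ℝ, ω ∉ B → angularFourierL2 x ω = 0}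

/-- Processes given by spectral data supported in `S`. -/
def bandM (S : Set ℝ) : Set (ℝ → ℂ) :=
  {x | ∃ X : SpectralData, X.SupportedIn S ∧ x = X.process}

theorem lowL2_eq (Ω : ℝ) : lowL2 Ω = bandL2 {ω | |ω| ≤ Ω} := by
  simp [lowL2, bandL2]

theorem highL2_eq (Ω : ℝ) : highL2 Ω = bandL2 {ω | Ω ≤ |ω|} := by
  simp [highL2, bandL2]

theorem isL2OrBounded_of_mem {B S : Set ℝ} {x : ℝ → ℂ} (hx : x ∈ bandL2 B ∪ bandM S) :
    IsL2OrBounded x := by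
  rcases hx with hx | ⟨X, -, rfl⟩
  · exact Or.inl hx.1
  · exact X.isL2OrBounded_process

/-- Transfer functions can be cut off to `B` without change on `S`. -/
def HasCutoff (S B : Set ℝ) : Prop :=
  ∀ g : ℝ → ℂ, Integrable g → ∃ h : ℝ → ℂ, Integrable h ∧
    (∀ ω ∈ S, angularFourierL1 g ω = angularFourierL1 h ω) ∧
    (∀ ω ∈ B, ‖angularFourierL1 h ω‖ ≤ ‖angularFourierL1 g ω‖) ∧
    ∀ ω ∉ B, angularFourierL1 h ω = 0

theorem hasCutoff_low {Ω ε : ℝ} (hε : 0 < ε) (hεΩ : ε < Ω) :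
    HasCutoff {ω | |ω| ≤ Ω - ε} {ω | |ω| ≤ Ω} := by
  intro g hg
  let b : ContDiffBump (0 : ℝ) := ⟨Ω - ε, Ω, by linarith, by linarith⟩
  obtain ⟨h, hh, hb⟩ := exists_integrable_transfer_mul_bump hg b
  refine ⟨h, hh, fun ω hω => ?_, fun ω _ => ?_, fun ω hω => ?_⟩
  · rw [hb, b.one_of_mem_closedBall (by simpa using hω)]
    simp
  · rw [hb, norm_mul, Complex.norm_real, Real.norm_of_nonneg b.nonneg]
    exact mul_le_of_le_one_left (norm_nonneg _) b.le_one
  · rw [hb, b.zero_of_le_dist (by simpa using (not_le.1 hω).le)]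
    simp

theorem hasCutoff_high {Ω ε : ℝ} (hε : 0 < ε) (hΩ : 0 < Ω) :
    HasCutoff {ω | Ω + ε ≤ |ω|} {ω | Ω ≤ |ω|} := by
  intro g hg
  let b : ContDiffBump (0 : ℝ) := ⟨Ω, Ω + ε, hΩ, by linarith⟩
  -- The cutoff to high frequencies is 1 - b, which has no compact support; it is realized by
  -- subtracting the low-pass part h from g.
  obtain ⟨h, hh, hb⟩ := exists_integrable_transfer_mul_bump hg b
  have hb' : ∀ ω, angularFourierL1 (g + (-1 : ℂ) • h) ω =
      ((1 - b ω : ℝ) : ℂ) * angularFourierL1 g ω := fun ω => by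
    rw [angularFourierL1_add hg (hh.smul _), angularFourierL1_smul, hb]
    push_cast
    ring
  refine ⟨_, hg.add (hh.smul (-1 : ℂ)), fun ω hω => ?_, fun ω _ => ?_, fun ω hω => ?_⟩
  · rw [hb', b.zero_of_le_dist (by simpa using hω)]
    simp
  · rw [hb', norm_mul, Complex.norm_real, Real.norm_of_nonneg (sub_nonneg.2 b.le_one)]
    exact mul_le_of_le_one_left (norm_nonneg _) (by linarith [b.nonneg (x := ω)])
  · rw [hb', b.one_of_mem_closedBall (by simpa using (not_le.1 hω).le)]
    simp

/-- One kernel serves both classes. Square integrable processes use the L₂ norm of v through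
Cauchy–Schwarz; the others use only |v| ≤ 1, together with the cutoff. -/
theorem exists_isUniformPredictor_top {Ω : ℝ} {k : ℝ → ℝ} (hk : k ∈ futureKernels Ω)
    {S B : Set ℝ} (hB : IsArcBand B) (hSB : HasCutoff S B) {η : ℝ} (hη : 0 < η) :
    ∃ κ, IsUniformPredictor ⊤ η k κ
      (withFourierNorm 2 (bandL2 B) ∪ withDualNorm (bandM S)) := by
  set C := eLpNorm (fun ω : ℝ => (1 + Complex.I * ω)⁻¹) 2 volume
  have hC : C ≠ ⊤ := memLp_two_inv_one_add_I_mul.eLpNorm_ne_top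
  -- Chosen so that both η' C ≤ η, for square integrable processes, and η' ≤ η, for processes with a
  -- dual norm.
  set η' := η / (1 + C.toReal)
  have hC0 : 0 ≤ C.toReal := ENNReal.toReal_nonneg
  have hη' : 0 < η' := by positivity
  have hle : η' ≤ η := div_le_self hη.le (by linarith)
  have hleC : ENNReal.ofReal η' * C ≤ ENNReal.ofReal η := by
    rw [← ENNReal.ofReal_toReal hC, ← ENNReal.ofReal_mul hη'.le]
    refine ENNReal.ofReal_le_ofReal ?_
    rw [div_mul_eq_mul_div, div_le_iff₀ (by positivity)]
    nlinarith
  obtain ⟨κ, hκ, hκ1, hκ2, hG⟩ := exists_predicting_kernel hk hB η' hη'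
  obtain ⟨hk1, hk2, -⟩ := futureKernels_integrable hk
  have herr := fun {x : ℝ → ℂ} (hx : IsL2OrBounded x) =>
    predictionError_eq_integral hk.1 hk1 hk2 hκ.1 hκ1 hκ2 hx
  have hg1 := hk1.sub hκ1
  have hg2 := hk2.sub hκ2
  refine ⟨κ, hκ, ?_⟩
  rintro ⟨x, N⟩ (⟨hx, hN⟩ | ⟨hx, X, hxX, hN⟩)
  all_goals
    simp only at hx hN ⊢
    subst hN
  · have hx' : IsL2OrBounded x := Or.inl hx.1
    refine ⟨fun t => (hx'.integrable_mul hκ1 hκ2 t).integrableOn, ?_⟩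
    rw [herr hx']
    refine (eLpNorm_top_filtered_le hg1 hg2 hx.1).trans ?_
    refine (eLpNorm_filteredSpectrum_le hx.1 hη'.le hG hx.2 2 2 1).trans ?_
    rw [← mul_assoc]
    gcongr
  · have hx' : IsL2OrBounded x := isL2OrBounded_of_mem (B := B) (Or.inr hx)
    refine ⟨fun t => (hx'.integrable_mul hκ1 hκ2 t).integrableOn, ?_⟩
    rw [herr hx', eLpNorm_exponent_top]
    refine eLpNormEssSup_le_of_ae_enorm_bound (Eventually.of_forall fun t => ?_)
    obtain ⟨X', hX', hxX'⟩ := hx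
    simp only at hxX hxX'
    obtain ⟨h, hh, h1, h2, h3⟩ := hSB _ hg1
    have hbound : ∀ ω, ‖angularFourierL1 h ω‖ ≤ η := by
      intro ω
      by_cases hω : ω ∈ B
      · refine (h2 ω hω).trans ((hG ω hω).trans ?_)
        exact (mul_le_of_le_one_right hη'.le (norm_inv_one_add_I_mul_le ω)).trans hle
      · rw [h3 ω hω, norm_zero]
        exact hη.le
    have := norm_integral_mul_process_le hg1 hh (hxX.symm.trans hxX') hX' h1 hη.le hbound t
    rw [← hxX] at this
    rw [← ofReal_norm, ← ofReal_norm, ← ENNReal.ofReal_mul hη.le]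
    exact ENNReal.ofReal_le_ofReal this

theorem exists_isUniformPredictor_two {Ω : ℝ} {k : ℝ → ℝ} (hk : k ∈ futureKernels Ω)
    {B : Set ℝ} (hB : IsArcBand B) {η : ℝ} (hη : 0 < η) {q : ℝ≥0∞} (hq : 2 ≤ q) :
    ∃ κ, IsUniformPredictor 2 η k κ (withFourierNorm q (bandL2 B)) := by
  obtain ⟨s, hs, hsq⟩ := exists_holderTriple_two hq
  set C := eLpNorm (fun ω : ℝ => (1 + Complex.I * ω)⁻¹) s volume
  have hC : C ≠ ⊤ := (memLp_inv_one_add_I_mul hs).eLpNorm_ne_top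
  set η' := η / (1 + C.toReal)
  have hC0 : 0 ≤ C.toReal := ENNReal.toReal_nonneg
  have hη' : 0 < η' := by positivity
  have hleC : ENNReal.ofReal η' * C ≤ ENNReal.ofReal η := by
    rw [← ENNReal.ofReal_toReal hC, ← ENNReal.ofReal_mul hη'.le]
    refine ENNReal.ofReal_le_ofReal ?_
    rw [div_mul_eq_mul_div, div_le_iff₀ (by positivity)]
    nlinarith
  obtain ⟨κ, hκ, hκ1, hκ2, hG⟩ := exists_predicting_kernel hk hB η' hη'
  obtain ⟨hk1, hk2, -⟩ := futureKernels_integrable hk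
  refine ⟨κ, hκ, ?_⟩
  rintro ⟨x, N⟩ ⟨hx, hN⟩
  simp only at hx hN ⊢
  subst hN
  have hx' : IsL2OrBounded x := Or.inl hx.1
  refine ⟨fun t => (hx'.integrable_mul hκ1 hκ2 t).integrableOn, ?_⟩
  rw [predictionError_eq_integral hk.1 hk1 hk2 hκ.1 hκ1 hκ2 hx']
  refine (eLpNorm_two_filtered (hk1.sub hκ1) (hk2.sub hκ2) hx.1).trans_le ?_
  refine (eLpNorm_filteredSpectrum_le hx.1 hη'.le hG hx.2 s q 2).trans ?_
  rw [← mul_assoc]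
  gcongr

/-! ### From uniform bounds to sequences and sums -/

theorem fourierNorm_two_ne_top {x : ℝ → ℂ} (hx : MemLp x 2) : fourierNorm 2 x ≠ ⊤ := by
  rw [fourierNorm, angularFourierL2_of_memLp hx]
  have hmap : Measure.map (fun ω : ℝ => ω / (2 * Real.pi)) volume =
      ENNReal.ofReal (2 * Real.pi) • volume := by
    simp_rw [div_eq_mul_inv]
    rw [Real.map_volume_mul_right (by positivity), inv_inv, abs_of_pos (by positivity)]
  have h : MemLp (𝓕 (hx.toLp x) : Lp ℂ 2 (volume : Measure ℝ)) 2
      (Measure.map (fun ω : ℝ => ω / (2 * Real.pi)) volume) := by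
    rw [hmap]
    exact (Lp.memLp _).smul_measure ENNReal.ofReal_ne_top
  exact (h.comp_of_map (by fun_prop)).eLpNorm_ne_top

theorem exists_isPredictorSeq {r : ℝ≥0∞} {k : ℝ → ℝ} {𝒞 : Set ((ℝ → ℂ) × ℝ≥0∞)}
    {S : Set (ℝ → ℂ)} (h : ∀ η : ℝ, 0 < η → ∃ κ, IsUniformPredictor r η k κ 𝒞)
    (hS : ∀ x ∈ S, ∃ N : ℝ≥0∞, N ≠ ⊤ ∧ (x, N) ∈ 𝒞) : ∃ κ, IsPredictorSeq r k κ S := by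
  -- The error of the m-th kernel is at most N / (m + 1), which tends to zero because the norm N of
  -- each process is finite.
  choose κ hκ using fun m : ℕ => h (1 / (m + 1)) (by positivity)
  refine ⟨κ, fun m => (hκ m).1, fun x hx => ?_⟩
  obtain ⟨N, hN, hxN⟩ := hS x hx
  refine ⟨fun m => ((hκ m).2 _ hxN).1, ?_⟩
  have h0 : Tendsto (fun m : ℕ => ENNReal.ofReal (1 / ((m : ℝ) + 1)) * N) atTop (𝓝 0) := by
    have h1 := ENNReal.tendsto_ofReal (tendsto_one_div_add_atTop_nhds_zero_nat (𝕜 := ℝ))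
    rw [ENNReal.ofReal_zero] at h1
    simpa using ENNReal.Tendsto.mul_const h1 (Or.inr hN)
  exact tendsto_of_tendsto_of_tendsto_of_le_of_le tendsto_const_nhds h0 (fun _ => zero_le)
    fun m => ((hκ m).2 _ hxN).2

theorem weaklyPredictableBySum_of_uniform {Ω : ℝ} {k : ℝ → ℝ} (hk : k ∈ futureKernels Ω)
    {r : ℝ≥0∞} (hr : 1 ≤ r) {𝒞L 𝒞H : Set ((ℝ → ℂ) × ℝ≥0∞)} {SL SH : Set (ℝ → ℂ)}
    (hL : ∀ η : ℝ, 0 < η → ∃ κ, IsUniformPredictor r η k κ 𝒞L)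
    (hH : ∀ η : ℝ, 0 < η → ∃ κ, IsUniformPredictor r η k κ 𝒞H)
    (hSL : ∀ x ∈ SL, IsL2OrBounded x ∧ ∃ N : ℝ≥0∞, N ≠ ⊤ ∧ (x, N) ∈ 𝒞L)
    (hSH : ∀ x ∈ SH, IsL2OrBounded x ∧ ∃ N : ℝ≥0∞, N ≠ ⊤ ∧ (x, N) ∈ 𝒞H) :
    WeaklyPredictableBySum r k SL SH := by
  obtain ⟨κL, hκL⟩ := exists_isPredictorSeq hL fun x hx => (hSL x hx).2
  obtain ⟨κH, hκH⟩ := exists_isPredictorSeq hH fun x hx => (hSH x hx).2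
  refine ⟨κL, κH, hκL, hκH, fun xL hxL xH hxH => ?_⟩
  have h := ((hκL.2 xL hxL).2.add (hκH.2 xH hxH).2)
  rw [add_zero] at h
  exact tendsto_of_tendsto_of_tendsto_of_le_of_le tendsto_const_nhds h (fun _ => zero_le)
    fun m => eLpNorm_jointError_le hk (hκL.1 m) (hκH.1 m) (hSL xL hxL).1 (hSH xH hxH).1 hr

theorem uniformlyPredictableBySum_of_uniform {Ω : ℝ} {k : ℝ → ℝ} (hk : k ∈ futureKernels Ω)
    {r : ℝ≥0∞} (hr : 1 ≤ r) {𝒞L 𝒞H : Set ((ℝ → ℂ) × ℝ≥0∞)}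
    (hL : ∀ η : ℝ, 0 < η → ∃ κ, IsUniformPredictor r η k κ 𝒞L)
    (hH : ∀ η : ℝ, 0 < η → ∃ κ, IsUniformPredictor r η k κ 𝒞H)
    (h𝒞L : ∀ p ∈ 𝒞L, IsL2OrBounded p.1) (h𝒞H : ∀ p ∈ 𝒞H, IsL2OrBounded p.1) :
    UniformlyPredictableBySum r k 𝒞L 𝒞H := by
  intro η hη
  obtain ⟨κL, hκL⟩ := hL η hη
  obtain ⟨κH, hκH⟩ := hH η hη
  refine ⟨κL, κH, hκL, hκH, fun p hp q hq => ?_⟩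
  rw [mul_add]
  exact (eLpNorm_jointError_le hk hκL.1 hκH.1 (h𝒞L p hp) (h𝒞H q hq) hr).trans
    (add_le_add (hκL.2 p hp).2 (hκH.2 q hq).2)

theorem exists_finite_norm_of_mem {B S : Set ℝ} {x : ℝ → ℂ} (hx : x ∈ bandL2 B ∪ bandM S) :
    ∃ N : ℝ≥0∞, N ≠ ⊤ ∧ (x, N) ∈ withFourierNorm 2 (bandL2 B) ∪ withDualNorm (bandM S) := by
  rcases hx with hx | hx
  · exact ⟨_, fourierNorm_two_ne_top hx.1, Or.inl ⟨hx, rfl⟩⟩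
  · obtain ⟨X, -, hX⟩ := id hx
    exact ⟨‖X.functional‖ₑ, enorm_ne_top, Or.inr ⟨hx, X, hX, rfl⟩⟩

theorem corollary1 (Ω ε : ℝ) (hε : 0 < ε) (hεΩ : ε < Ω)
    (k : ℝ → ℝ) (hk : k ∈ futureKernels Ω) :
    -- the processes `y_L`, `y_H` are well defined, and `y = y_L + y_H`
    (∀ xL ∈ lowL2 Ω ∪ lowM Ω ε, ∀ xH ∈ highL2 Ω ∪ highM Ω ε,
      FutureConverges k xL ∧ FutureConverges k xH ∧
      FutureConverges k (fun s => xL s + xH s) ∧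
      ∀ t, futureConv k (fun s => xL s + xH s) t = futureConv k xL t + futureConv k xH t) ∧
    -- whatever predicting kernels are used for the two parts, the errors add up at most
    (∀ r : ℝ≥0∞, 1 ≤ r → ∀ κL ∈ pastKernels, ∀ κH ∈ pastKernels,
      ∀ xL ∈ lowL2 Ω ∪ lowM Ω ε, ∀ xH ∈ highL2 Ω ∪ highM Ω ε,
      PastConverges κL xL → PastConverges κH xH →
      eLpNorm (jointError k κL κH xL xH) r (volume : Measure ℝ) ≤
        eLpNorm (predictionError k κL xL) r (volume : Measure ℝ) +
          eLpNorm (predictionError k κH xH) r (volume : Measure ℝ)) ∧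
    -- prediction in `L_∞`, for all four combinations of the classes
    WeaklyPredictableBySum ⊤ k (lowL2 Ω ∪ lowM Ω ε) (highL2 Ω ∪ highM Ω ε) ∧
    UniformlyPredictableBySum ⊤ k (lowNormed Ω ε) (highNormed Ω ε) ∧
    -- prediction in `L_2`, when both parts are square integrable
    WeaklyPredictableBySum 2 k (lowL2 Ω) (highL2 Ω) ∧
    (∀ q : ℝ≥0∞, 2 < q →
      UniformlyPredictableBySum 2 k
        (withFourierNorm q (lowL2 Ω)) (withFourierNorm q (highL2 Ω))) := by
  have hΩ : 0 < Ω := hε.trans hεΩ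
  have hBL := isArcBand_low hΩ
  have hBH := isArcBand_high hΩ
  have hcL := hasCutoff_low hε hεΩ
  have hcH := hasCutoff_high hε hΩ
  have hmL : lowM Ω ε = bandM {ω | |ω| ≤ Ω - ε} := rfl
  have hmH : highM Ω ε = bandM {ω | Ω + ε ≤ |ω|} := rfl
  unfold lowNormed highNormed
  rw [lowL2_eq, highL2_eq, hmL, hmH]
  refine ⟨fun xL hxL xH hxH => ?_, fun r hr κL hκL κH hκH xL hxL xH hxH _ _ => ?_, ?_, ?_, ?_,
    fun q hq => ?_⟩
  · have hL := futureConverges_of_mem hk (isL2OrBounded_of_mem hxL)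
    have hH := futureConverges_of_mem hk (isL2OrBounded_of_mem hxH)
    refine ⟨hL, hH, fun t => ?_, futureConv_add hL hH⟩
    simpa only [mul_add] using! (hL t).add (hH t)
  · exact eLpNorm_jointError_le hk hκL hκH (isL2OrBounded_of_mem hxL) (isL2OrBounded_of_mem hxH) hr
  · exact weaklyPredictableBySum_of_uniform hk le_top
      (fun η hη => exists_isUniformPredictor_top hk hBL hcL hη)
      (fun η hη => exists_isUniformPredictor_top hk hBH hcH hη)
      (fun x hx => ⟨isL2OrBounded_of_mem hx, exists_finite_norm_of_mem hx⟩)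
      (fun x hx => ⟨isL2OrBounded_of_mem hx, exists_finite_norm_of_mem hx⟩)
  · refine uniformlyPredictableBySum_of_uniform hk le_top
      (fun η hη => exists_isUniformPredictor_top hk hBL hcL hη)
      (fun η hη => exists_isUniformPredictor_top hk hBH hcH hη) ?_ ?_
    all_goals
      rintro p (hp | hp)
      · exact Or.inl hp.1.1
      · exact isL2OrBounded_of_mem (B := ∅) (Or.inr hp.1)
  -- The exponent q = 2 suffices here: Hölder with s = ∞ bounds the error by η ‖X‖₂, which is finite
  -- for every square integrable process.
  · exact weaklyPredictableBySum_of_uniform hk one_le_two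
      (fun η hη => exists_isUniformPredictor_two hk hBL hη le_rfl)
      (fun η hη => exists_isUniformPredictor_two hk hBH hη le_rfl)
      (fun x hx => ⟨Or.inl hx.1, _, fourierNorm_two_ne_top hx.1, hx, rfl⟩)
      (fun x hx => ⟨Or.inl hx.1, _, fourierNorm_two_ne_top hx.1, hx, rfl⟩)
  · exact uniformlyPredictableBySum_of_uniform hk one_le_two
      (fun η hη => exists_isUniformPredictor_two hk hBL hη hq.le)
      (fun η hη => exists_isUniformPredictor_two hk hBH hη hq.le)
      (fun p hp => Or.inl hp.1.1) (fun p hp => Or.inl hp.1.1)
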